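/- **Theorem 2.2.** Let $\mathcal{A}$ be a complex unital Banach algebra. An element $x\in\mathcal A$ is *generalized Drazin invertible*, $x\in\mathcal{A}^d$, if there is a (then unique) element $x^d\in\mathcal A$ with $x^d x x^d=x^d$, $xx^d=x^dx$ and $x-x^2x^d$ quasinilpotent (i.e. of spectral radius $0$); in that case $x^\pi:=1-xx^d$. Let $a,b\in\mathcal{A}^d$ satisfy $aba^\pi=a^\pi b^\pi bab^\pi a^\pi$ and $a^2a^db=aa^dba$, and suppose that at least one of the elements $a^\pi ba^\pi$, $a^\pi b$, $ba^\pi$, $aa^dbaa^d$, $aa^db$, $baa^d$ is generalized Drazin invertible. Then $$a+b\in\mathcal{A}^d \iff 1+a^db\in\mathcal{A}^d \iff aa^d(1+a^db)\in\mathcal{A}^d \iff (1+a^db)aa^d\in\mathcal{A}^d \iff aa^d(1+a^db)aa^d\in\mathcal{A}^d.$$ In this case, put $c=aa^d(a+b)$. Then $c\in\mathcal{A}^d$, $$c^d=a^d(1+a^db)^d\,bb^d+\sum_{n=0}^{\infty}aa^d\,b^\pi(-b)^n(a^d)^{n+1},$$ and $$\begin{aligned}(a+b)^d={}&c^d+\sum_{n=0}^{\infty}(b^d)^{n+1}a^na^\pi-\sum_{n=0}^{\infty}(b^d)^{n+1}a^na^\pi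 b\,c^d+\sum_{n=0}^{\infty}\sum_{k=0}^{\infty}(b^d)^{n+k+2}a^ka^\pi b\,aa^d\,c^nc^\pi\\&+\sum_{n=0}^{\infty}b^\pi(a+b)^na^\pi b\,(c^d)^{n+2}-\sum_{n=0}^{\infty}\sum_{k=0}^{\infty}(b^d)^{k+1}a^{k+1}(a+b)^na^\pi b\,(c^d)^{n+2},\end{aligned}$$ where all the series converge unconditionally (in the double series the inner series, over $k$, converges for each $n$, and so does the outer series over $n$ of the inner sums). -/

import Mathlib

/-- An element of a complex Banach algebra is quasinilpotent if its spectral radius is zero. -/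
def IsQuasinilpotent {A : Type*} [NormedRing A] [NormedAlgebra ℂ A] (a : A) : Prop :=
  spectralRadius ℂ a = 0

/-- `x` is a generalized Drazin (Koliha-Drazin) inverse of `a`. -/
structure IsGDrazinInverse {A : Type*} [NormedRing A] [NormedAlgebra ℂ A] (a x : A) : Prop where
  outer : x * a * x = x
  comm : a * x = x * a
  quasinilpotent : IsQuasinilpotent (a - a ^ 2 * x)

/-- `a` belongs to the set of generalized Drazin invertible elements. -/
def IsGDrazinInvertible {A : Type*} [NormedRing A] [NormedAlgebra ℂ A] (a : A) : Prop :=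
  ∃ x : A, IsGDrazinInverse a x

open Classical in
/-- The generalized Drazin inverse of `a` (with the value `0` if `a` is not generalized Drazin
invertible). Uniqueness is `IsGDrazinInverse.eq_gDrazinInv` below. -/
noncomputable def gDrazinInv {A : Type*} [NormedRing A] [NormedAlgebra ℂ A] (a : A) : A :=
  if h : IsGDrazinInvertible a then h.choose else 0

/-- `aᵈ` is the generalized Drazin inverse of `a`. -/
postfix:max "ᵈ" => gDrazinInv

/-- The spectral idempotent `1 - a aᵈ` of `a` corresponding to `{0}`. -/
noncomputable def spectralIdem {A : Type*} [NormedRing A] [NormedAlgebra ℂ A] (a : A) : A :=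
  1 - a * aᵈ

/-- `aᵖ` is the spectral idempotent of `a`. -/
postfix:max "ᵖ" => spectralIdem

theorem IsGDrazinInvertible.isGDrazinInverse {A : Type*} [NormedRing A] [NormedAlgebra ℂ A]
    {a : A} (h : IsGDrazinInvertible a) : IsGDrazinInverse a aᵈ := by
  unfold gDrazinInv
  rw [dif_pos h]
  exact h.choose_spec

/-- Powers of a quasinilpotent element beat every geometric sequence. -/
theorem IsQuasinilpotent.tendsto {A : Type*} [NormedRing A] [NormedAlgebra ℂ A] [CompleteSpace A]
    {q : A} (h : IsQuasinilpotent q) {r : ℝ} (hr : 0 ≤ r) :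
    Filter.Tendsto (fun n : ℕ => r ^ n * ‖q ^ n‖) Filter.atTop (nhds 0) := by
  have h1 := spectrum.pow_norm_pow_one_div_tendsto_nhds_spectralRadius q
  rw [show spectralRadius ℂ q = 0 from h] at h1
  set ε : ℝ := (2 * (r + 1))⁻¹ with hε
  have hεpos : 0 < ε := by positivity
  have h2 := h1.eventually (gt_mem_nhds (ENNReal.ofReal_pos.2 hεpos))
  refine squeeze_zero' (g := fun n : ℕ => ((1 : ℝ) / 2) ^ n)
    (Filter.Eventually.of_forall fun n => by positivity) ?_
    (tendsto_pow_atTop_nhds_zero_of_lt_one (by norm_num) (by norm_num))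
  filter_upwards [h2, Filter.eventually_gt_atTop 0] with n hn hn0
  have h3 : ‖q ^ n‖ ^ (1 / n : ℝ) < ε := (ENNReal.ofReal_lt_ofReal_iff hεpos).1 hn
  have h4 : ‖q ^ n‖ ≤ ε ^ n := by
    have h5 : (‖q ^ n‖ ^ (1 / n : ℝ)) ^ n = ‖q ^ n‖ := by
      rw [one_div]
      exact Real.rpow_inv_natCast_pow (norm_nonneg _) hn0.ne'
    rw [← h5]
    exact pow_le_pow_left₀ (by positivity) h3.le n
  calc r ^ n * ‖q ^ n‖ ≤ r ^ n * ε ^ n := by gcongr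
    _ = (r * ε) ^ n := by rw [mul_pow]
    _ ≤ (1 / 2) ^ n := by
      refine pow_le_pow_left₀ (by positivity) ?_ n
      rw [hε, ← div_eq_mul_inv, div_le_div_iff₀ (by positivity) (by norm_num)]
      linarith

/-- The generalized Drazin inverse is unique. -/
theorem IsGDrazinInverse.unique {A : Type*} [NormedRing A] [NormedAlgebra ℂ A] [CompleteSpace A]
    {a x y : A} (hx : IsGDrazinInverse a x) (hy : IsGDrazinInverse a y) : x = y := by
  have key : ∀ {u v : A}, IsGDrazinInverse a u → IsGDrazinInverse a v →
      u * a * (1 - a * v) = 0 ∧ (1 - a * v) * (a * u) = 0 := by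
    intro u v hu hv
    have cu : Commute a u := hu.comm
    have cv : Commute a v := hv.comm
    have iu : IsIdempotentElem (u * a) := by
      unfold IsIdempotentElem
      rw [← mul_assoc, hu.outer]
    have iv : IsIdempotentElem (1 - a * v) := by
      refine IsIdempotentElem.one_sub ?_
      unfold IsIdempotentElem
      rw [mul_assoc, ← mul_assoc v, hv.outer]
    have ca : Commute a (1 - a * v) :=
      (Commute.one_right a).sub_right ((Commute.refl a).mul_right cv)
    have hq : a - a ^ 2 * v = a * (1 - a * v) := by rw [mul_sub, mul_one, pow_two, mul_assoc]
    have hlim := hv.quasinilpotent.tendsto (norm_nonneg u)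
    rw [hq] at hlim
    have pw : ∀ n : ℕ, 0 < n → (a * (1 - a * v)) ^ n = a ^ n * (1 - a * v) := by
      intro n hn
      rw [ca.mul_pow, iv.pow_eq hn.ne']
    have e1 : ∀ n : ℕ, 0 < n →
        u * a * (1 - a * v) = u ^ n * (a * (1 - a * v)) ^ n := by
      intro n hn
      rw [pw n hn, ← mul_assoc, ← cu.symm.mul_pow, iu.pow_eq hn.ne']
    have e2 : ∀ n : ℕ, 0 < n →
        (1 - a * v) * (a * u) = (a * (1 - a * v)) ^ n * u ^ n := by
      intro n hn
      rw [pw n hn, (ca.pow_left n).eq, mul_assoc, ← cu.mul_pow, cu.eq, iu.pow_eq hn.ne']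
    constructor
    · refine norm_le_zero_iff.1 (ge_of_tendsto hlim ?_)
      filter_upwards [Filter.eventually_gt_atTop 0] with n hn
      rw [e1 n hn]
      exact (norm_mul_le _ _).trans (by gcongr; exact norm_pow_le' _ hn)
    · refine norm_le_zero_iff.1 (ge_of_tendsto hlim ?_)
      filter_upwards [Filter.eventually_gt_atTop 0] with n hn
      rw [e2 n hn, mul_comm (‖u‖ ^ n)]
      exact (norm_mul_le _ _).trans (by gcongr; exact norm_pow_le' _ hn)
  have h1 : x * a = x * a * (a * y) := by
    have := (key hx hy).1
    rwa [mul_sub, mul_one, sub_eq_zero] at this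
  have h2 : a * y = a * x * (a * y) := by
    have := (key hy hx).2
    rwa [sub_mul, one_mul, sub_eq_zero] at this
  have h3 : a * x = a * y := by
    rw [hx.comm, h1, ← hx.comm, ← h2]
  calc x = x * (a * x) := by rw [← mul_assoc, hx.outer]
    _ = a * x * y := by rw [h3, ← mul_assoc, ← hx.comm, h3]
    _ = y := by rw [h3, hy.comm, hy.outer]

theorem IsGDrazinInverse.eq_gDrazinInv {A : Type*} [NormedRing A] [NormedAlgebra ℂ A]
    [CompleteSpace A] {a x : A} (h : IsGDrazinInverse a x) : aᵈ = x :=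
  IsGDrazinInverse.unique (IsGDrazinInvertible.isGDrazinInverse ⟨x, h⟩) h

/-!
Write `p = a aᵈ`. The relation `a² aᵈ b = a aᵈ b a` gives `p b (1 - p) = 0`, and each of the six
corner conditions forces `p bᵈ (1 - p) = 0`, so `a + b`, `b` and `bᵈ` are lower triangular with
respect to `p`. On the complementary corner `a` is quasinilpotent, and the other relation says there
that `a b bᵈ = 0` and that `a` commutes with `b (1 - b bᵈ)`; hence `(a + b)(1 - p)` has the
generalized Drazin inverse `∑ (bᵈ)ⁿ⁺¹ aⁿ (1 - p)`. Therefore `a + b` is generalized Drazin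
invertible exactly when the other diagonal entry `c = p (a + b)` is, and the entry of `(a + b)ᵈ`
below the diagonal solves a Sylvester equation, whose solution is the sum of two series and the
product `-(∑ (bᵈ)ⁿ⁺¹ aⁿ (1 - p)) b cᵈ`.

The factorization `c = (a p) (p (1 + aᵈ b))` into commuting elements yields the equivalences and
`cᵈ = aᵈ (1 + aᵈ b)ᵈ`. Multiplying by `1 = b bᵈ + (1 - b bᵈ)` gives the formula for `cᵈ`: after
compression by `1 - b bᵈ`, the element `c` is the sum of a group invertible and a commuting
quasinilpotent element, whose generalized Drazin inverse is a Neumann series.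
-/

section Quasinilpotent

variable {A : Type*} [NormedRing A] [NormedAlgebra ℂ A]

theorem isQuasinilpotent_iff_forall_isUnit {q : A} :
    IsQuasinilpotent q ↔ ∀ z : ℂ, z ≠ 0 → IsUnit (algebraMap ℂ A z - q) := by
  simp only [IsQuasinilpotent, spectralRadius, ENNReal.iSup_eq_zero, ENNReal.coe_eq_zero,
    nnnorm_eq_zero, spectrum.mem_iff]
  exact forall_congr' fun z => by tauto

theorem isQuasinilpotent_mul_comm {x y : A} :
    IsQuasinilpotent (x * y) ↔ IsQuasinilpotent (y * x) := by
  suffices h : ∀ {x y : A}, IsQuasinilpotent (x * y) → IsQuasinilpotent (y * x) from ⟨h, h⟩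
  intro x y h
  rw [isQuasinilpotent_iff_forall_isUnit] at h ⊢
  intro z hz
  by_contra hyx
  have hmem : z ∈ spectrum ℂ (y * x) \ {0} := ⟨hyx, hz⟩
  rw [spectrum.nonzero_mul_comm] at hmem
  exact hmem.1 (h z hz)

theorem isQuasinilpotent_op {q : A} : IsQuasinilpotent (MulOpposite.op q) ↔ IsQuasinilpotent q := by
  simp only [isQuasinilpotent_iff_forall_isUnit, MulOpposite.algebraMap_apply,
    ← MulOpposite.op_sub, isUnit_op]

namespace IsQuasinilpotent

theorem zero : IsQuasinilpotent (0 : A) := spectrum.spectralRadius_zero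

theorem add_of_mul_eq_zero {u v : A} (hu : IsQuasinilpotent u) (hv : IsQuasinilpotent v)
    (huv : u * v = 0) : IsQuasinilpotent (u + v) := by
  rw [isQuasinilpotent_iff_forall_isUnit] at *
  intro z hz
  have hz' : IsUnit (algebraMap ℂ A z) := (IsUnit.mk0 z hz).map (algebraMap ℂ A)
  have hfactor : algebraMap ℂ A z * (algebraMap ℂ A z - (u + v)) =
      (algebraMap ℂ A z - u) * (algebraMap ℂ A z - v) := by
    linear_combination (norm := noncomm_ring) -huv - Algebra.commutes z u
  exact hz'.mul_left_iff.1 (hfactor ▸ (hu z hz).mul (hv z hz))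

theorem of_corners {p s : A} (hps : p * s * p = p * s)
    (hleft : IsQuasinilpotent (p * s)) (hright : IsQuasinilpotent (s * (1 - p))) :
    IsQuasinilpotent s := by
  have hright' : IsQuasinilpotent ((1 - p) * s) := isQuasinilpotent_mul_comm.1 hright
  have hzero : p * s * ((1 - p) * s) = 0 := by
    linear_combination (norm := noncomm_ring) -hps * s
  convert hleft.add_of_mul_eq_zero hright' hzero using 1
  noncomm_ring

variable [CompleteSpace A]

theorem of_tendsto {q : A}
    (h : ∀ r : ℝ, 0 ≤ r → Filter.Tendsto (fun n : ℕ => r ^ n * ‖q ^ n‖) Filter.atTop (nhds 0)) :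
    IsQuasinilpotent q := by
  rw [isQuasinilpotent_iff_forall_isUnit]
  intro z hz
  by_contra hmem
  have hlim := (h ‖z‖⁻¹ (by positivity)).mul_const ‖(1 : A)‖
  rw [zero_mul] at hlim
  refine absurd (ge_of_tendsto' hlim (b := 1) fun n => ?_) (by norm_num)
  have hle : ‖z‖ ^ n ≤ ‖q ^ n‖ * ‖(1 : A)‖ :=
    norm_pow z n ▸ spectrum.norm_le_norm_mul_of_mem (spectrum.pow_mem_pow q n hmem)
  rwa [inv_pow, mul_assoc, ← div_eq_inv_mul, le_div_iff₀ (by positivity), one_mul]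

theorem of_norm_pow_le {q t : A} (hq : IsQuasinilpotent q) {C r : ℝ} (hr : 0 ≤ r)
    (h : ∀ n : ℕ, n ≠ 0 → ‖t ^ n‖ ≤ C * r ^ n * ‖q ^ n‖) : IsQuasinilpotent t := by
  refine of_tendsto fun R hR => ?_
  have hlim := (hq.tendsto (mul_nonneg hR hr)).const_mul C
  rw [mul_zero] at hlim
  refine squeeze_zero' (.of_forall fun n => by positivity) ?_ hlim
  filter_upwards [Filter.eventually_ne_atTop 0] with n hn
  calc R ^ n * ‖t ^ n‖ ≤ R ^ n * (C * r ^ n * ‖q ^ n‖) := by gcongr; exact h n hn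
    _ = C * ((R * r) ^ n * ‖q ^ n‖) := by ring

theorem mul_of_commute {q x : A} (hq : IsQuasinilpotent q) (h : Commute q x) :
    IsQuasinilpotent (q * x) :=
  hq.of_norm_pow_le (C := 1) (norm_nonneg x) fun n hn => by
    rw [h.mul_pow, one_mul, mul_comm (‖x‖ ^ n)]
    exact (norm_mul_le _ _).trans (by gcongr; exact norm_pow_le' x (Nat.pos_of_ne_zero hn))

theorem mul_of_mul_mul_eq {p q : A} (hq : IsQuasinilpotent q) (h : p * q * p = p * q) :
    IsQuasinilpotent (p * q) :=
  hq.of_norm_pow_le (C := ‖p‖) zero_le_one fun n hn => by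
    obtain ⟨m, rfl⟩ := Nat.exists_eq_succ_of_ne_zero hn
    have hsemi : SemiconjBy p q (p * q) := h.symm
    have hpow : (p * q) ^ (m + 1) = p * q ^ (m + 1) := by
      rw [pow_succ, ← mul_assoc, ← (hsemi.pow_right m).eq, pow_succ, mul_assoc]
    rw [hpow, one_pow, mul_one]
    exact norm_mul_le _ _

theorem neg {q : A} (hq : IsQuasinilpotent q) : IsQuasinilpotent (-q) := by
  simpa using hq.mul_of_commute (Commute.neg_one_right q)

theorem add_of_commute {u v : A} (hu : IsQuasinilpotent u) (hv : IsQuasinilpotent v)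
    (h : Commute u v) : IsQuasinilpotent (u + v) := by
  rw [isQuasinilpotent_iff_forall_isUnit] at hu ⊢
  intro z hz
  obtain ⟨w, hw⟩ := hu z hz
  have hvw : Commute v (w⁻¹ : Aˣ) :=
    Commute.units_inv_right <| hw ▸ (Algebra.commute_algebraMap_right z v).sub_right h.symm
  have hunit : IsUnit (1 - (w⁻¹ : Aˣ) * v) := by
    simpa [hvw.eq] using
      isQuasinilpotent_iff_forall_isUnit.1 (hv.mul_of_commute hvw) 1 one_ne_zero
  have hfactor : algebraMap ℂ A z - (u + v) = w * (1 - (w⁻¹ : Aˣ) * v) := by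
    rw [mul_sub, mul_one, Units.mul_inv_cancel_left, hw, sub_sub]
  exact hfactor ▸ w.isUnit.mul hunit

theorem summable_norm {q : A} (hq : IsQuasinilpotent q) {r : ℝ} (hr : 0 ≤ r) :
    Summable fun n : ℕ => r ^ n * ‖q ^ n‖ := by
  have hlim := (hq.tendsto (r := 2 * r) (by positivity)).eventually_le_const zero_lt_one
  refine Summable.of_norm_bounded_eventually_nat summable_geometric_two ?_
  filter_upwards [hlim] with n hn
  rw [Real.norm_of_nonneg (by positivity), one_div, inv_pow, ← one_div,
    le_div_iff₀ (by positivity)]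
  calc r ^ n * ‖q ^ n‖ * 2 ^ n = (2 * r) ^ n * ‖q ^ n‖ := by ring
    _ ≤ 1 := hn

theorem summable_pow_mul_mul_pow {q : A} (hq : IsQuasinilpotent q) (s x : A) :
    Summable fun n : ℕ => q ^ n * s * x ^ n := by
  refine Summable.of_norm_bounded_eventually_nat
    ((hq.summable_norm (norm_nonneg x)).mul_right ‖s‖) ?_
  filter_upwards [Filter.eventually_gt_atTop 0] with n hn
  calc ‖q ^ n * s * x ^ n‖ ≤ ‖q ^ n‖ * ‖s‖ * ‖x ^ n‖ := norm_mul₃_le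
    _ ≤ ‖q ^ n‖ * ‖s‖ * ‖x‖ ^ n := by gcongr; exact norm_pow_le' x hn
    _ = ‖x‖ ^ n * ‖q ^ n‖ * ‖s‖ := by ring

theorem summable_pow_mul_mul_pow' {q : A} (hq : IsQuasinilpotent q) (s x : A) :
    Summable fun n : ℕ => x ^ n * s * q ^ n := by
  rw [← summable_op]
  simpa [Function.comp_def, mul_assoc] using
    (isQuasinilpotent_op.2 hq).summable_pow_mul_mul_pow (MulOpposite.op s) (MulOpposite.op x)

theorem eq_zero_of_eq_mul_mul {q t x : A} (hq : IsQuasinilpotent q) (h : t = x * t * q) :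
    t = 0 := by
  have hpow : ∀ n : ℕ, x ^ n * t * q ^ n = t := by
    intro n
    induction n with
    | zero => simp
    | succ n ih =>
      calc x ^ (n + 1) * t * q ^ (n + 1) = x ^ n * (x * t * q) * q ^ n := by
            rw [pow_succ x, pow_succ' q]; simp only [mul_assoc]
        _ = t := by rw [← h, ih]
  have hlim := (hq.summable_pow_mul_mul_pow' t x).tendsto_atTop_zero
  simp only [hpow] at hlim
  exact tendsto_nhds_unique tendsto_const_nhds hlim

end IsQuasinilpotent

end Quasinilpotent

namespace IsGDrazinInverse

variable {A : Type*} [NormedRing A] [NormedAlgebra ℂ A] {a b u s t x y z w p : A}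

theorem isQuasinilpotent_mul_one_sub (h : IsGDrazinInverse a x) :
    IsQuasinilpotent (a * (1 - a * x)) := by
  rw [mul_sub, mul_one, ← mul_assoc, ← pow_two]
  exact h.quasinilpotent

theorem of_isQuasinilpotent_mul_one_sub (houter : x * a * x = x) (hcomm : a * x = x * a)
    (hq : IsQuasinilpotent (a * (1 - a * x))) : IsGDrazinInverse a x :=
  ⟨houter, hcomm, by rwa [mul_sub, mul_one, ← mul_assoc, ← pow_two] at hq⟩

theorem of_inner_outer (hinner : a * x * a = a) (houter : x * a * x = x)
    (hcomm : a * x = x * a) : IsGDrazinInverse a x :=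
  of_isQuasinilpotent_mul_one_sub houter hcomm <| by
    rw [mul_sub, mul_one, hcomm, ← mul_assoc, hinner, sub_self]
    exact .zero

theorem of_isIdempotentElem (hp : IsIdempotentElem p) : IsGDrazinInverse p p :=
  of_inner_outer (by rw [hp.eq, hp.eq]) (by rw [hp.eq, hp.eq]) rfl

theorem op (h : IsGDrazinInverse a x) :
    IsGDrazinInverse (MulOpposite.op a) (MulOpposite.op x) where
  outer := by simp only [← MulOpposite.op_mul, ← mul_assoc, h.outer]
  comm := by simp only [← MulOpposite.op_mul, h.comm]
  quasinilpotent := by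
    rw [← MulOpposite.op_pow, ← MulOpposite.op_mul, ← MulOpposite.op_sub, isQuasinilpotent_op]
    have hcomm : x * a ^ 2 = a ^ 2 * x := ((show Commute a x from h.comm).pow_left 2).eq.symm
    rw [hcomm]
    exact h.quasinilpotent

theorem unop (h : IsGDrazinInverse (MulOpposite.op a) (MulOpposite.op x)) :
    IsGDrazinInverse a x where
  outer := by simpa only [← MulOpposite.op_mul, ← mul_assoc, MulOpposite.op_inj] using h.outer
  comm := by simpa only [← MulOpposite.op_mul, MulOpposite.op_inj] using h.comm.symm
  quasinilpotent := by
    have hcomm : Commute a x := MulOpposite.op_injective h.comm.symm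
    rw [(hcomm.pow_left 2).eq]
    exact isQuasinilpotent_op.1 h.quasinilpotent

theorem mul_self_mul (h : IsGDrazinInverse a x) : x * (a * x) = x := by
  rw [← mul_assoc, h.outer]

theorem self_mul_mul (h : IsGDrazinInverse a x) : a * x * x = x := by
  rw [h.comm, h.outer]

theorem mul_mul_self (h : IsGDrazinInverse a x) : x * x * a = x := by
  rw [mul_assoc, ← h.comm, h.mul_self_mul]

theorem isIdempotentElem (h : IsGDrazinInverse a x) : IsIdempotentElem (a * x) := by
  rw [IsIdempotentElem, mul_assoc, h.mul_self_mul]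

theorem commute_self_mul (h : IsGDrazinInverse a x) : Commute a (a * x) :=
  (Commute.refl a).mul_right h.comm

theorem one_sub_mul_self_mul_one_sub (h : IsGDrazinInverse a x) :
    (1 - a * x) * (a * (1 - a * x)) = a * (1 - a * x) := by
  have hcomm : Commute a (1 - a * x) := (Commute.one_right a).sub_right h.commute_self_mul
  rw [← mul_assoc, ← hcomm.eq, mul_assoc, h.isIdempotentElem.one_sub.eq]

theorem mul_eq_zero (h : IsGDrazinInverse a x) (hta : t * a = 0) :
    t * x = 0 := by
  rw [← h.self_mul_mul, mul_assoc, ← mul_assoc, hta, zero_mul]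

theorem mul_eq_zero' (h : IsGDrazinInverse a x) (hat : a * t = 0) :
    x * t = 0 := by
  rw [← h.mul_mul_self, mul_assoc, hat, mul_zero]

theorem pow_mul_one_sub (h : IsGDrazinInverse a x) (n : ℕ) :
    (a * (1 - a * x)) ^ n * (1 - a * x) = (1 - a * x) * a ^ n := by
  have hcomm : Commute a (1 - a * x) := (Commute.one_right a).sub_right h.commute_self_mul
  rw [hcomm.mul_pow, mul_assoc, ← pow_succ, h.isIdempotentElem.one_sub.pow_succ_eq,
    (hcomm.pow_left n).eq]

theorem core_and_inverse (h : IsGDrazinInverse a x) :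
    IsGDrazinInverse (a * (a * x)) x ∧ IsGDrazinInverse x (a * (a * x)) := by
  have hcx : a * (a * x) * x = a * x := by rw [mul_assoc, h.self_mul_mul]
  have hxc : x * (a * (a * x)) = a * x := by
    rw [← mul_assoc, ← h.comm, h.isIdempotentElem.eq]
  have hcomm : a * (a * x) * x = x * (a * (a * x)) := hcx.trans hxc.symm
  have hinner : a * (a * x) * x * (a * (a * x)) = a * (a * x) := by
    rw [mul_assoc _ x, hxc, mul_assoc, h.isIdempotentElem.eq]
  have houter : x * (a * (a * x)) * x = x := by rw [hxc, h.self_mul_mul]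
  exact ⟨of_inner_outer hinner houter hcomm, of_inner_outer houter hinner hcomm.symm⟩

theorem core (h : IsGDrazinInverse a x) : IsGDrazinInverse (a * (a * x)) x :=
  h.core_and_inverse.1

theorem inverse (h : IsGDrazinInverse a x) : IsGDrazinInverse x (a * (a * x)) :=
  h.core_and_inverse.2

theorem cline (h : IsGDrazinInverse (a * b) w) : IsGDrazinInverse (b * a) (b * w * w * a) := by
  have hleft : a * b * w * w = w := h.self_mul_mul
  have hright : w * w * (a * b) = w := h.mul_mul_self
  refine of_isQuasinilpotent_mul_one_sub ?_ ?_ ?_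
  · linear_combination (norm := noncomm_ring)
      b * w * w * a * b * hleft * a + b * hright * w * a
  · linear_combination (norm := noncomm_ring) b * hleft * a - b * hright * a
  · have hq : IsQuasinilpotent (b * (a * (1 - b * w * a))) := by
      rw [isQuasinilpotent_mul_comm]
      convert h.isQuasinilpotent_mul_one_sub using 1
      linear_combination (norm := noncomm_ring) a * b * h.comm
    convert hq using 1
    linear_combination (norm := noncomm_ring) -b * a * b * hleft * a

variable [CompleteSpace A]

-- `T = s z t (1 - u x)` satisfies `T = z T (u (1 - u x))`, which forces `T = 0`.
theorem mul_eq_mul_of_semiconjBy (hs : IsGDrazinInverse s z) (hu : IsGDrazinInverse u x)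
    (h : SemiconjBy t u s) : s * z * t = s * z * t * (u * x) := by
  have hfix : s * z * t * (1 - u * x) =
      z * (s * z * t * (1 - u * x)) * (u * (1 - u * x)) := by
    have hzs : z * (s * z * t) = z * t := by rw [← mul_assoc, hs.mul_self_mul]
    calc s * z * t * (1 - u * x) = z * (s * t) * (1 - u * x) := by
          rw [hs.comm]; noncomm_ring
      _ = z * t * u * (1 - u * x) := by rw [← h.eq, ← mul_assoc]
      _ = z * t * (1 - u * x) * (u * (1 - u * x)) := by
          rw [mul_assoc (z * t), mul_assoc (z * t), hu.one_sub_mul_self_mul_one_sub, ← mul_assoc]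
      _ = z * (s * z * t * (1 - u * x)) * (u * (1 - u * x)) := by
          rw [← mul_assoc z (s * z * t), hzs]
  have hzero := hu.isQuasinilpotent_mul_one_sub.eq_zero_of_eq_mul_mul hfix
  rwa [mul_sub, mul_one, sub_eq_zero] at hzero

theorem semiconjBy (hs : IsGDrazinInverse s z) (hu : IsGDrazinInverse u x)
    (h : SemiconjBy t u s) : SemiconjBy t x z := by
  have hleft : s * z * t = s * z * t * (u * x) := hs.mul_eq_mul_of_semiconjBy hu h
  have hright : t * (u * x) = s * z * t * (u * x) := by
    have hop : SemiconjBy (MulOpposite.op t) (MulOpposite.op s) (MulOpposite.op u) :=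
      congrArg MulOpposite.op h.eq.symm
    have := congrArg MulOpposite.unop (hu.op.mul_eq_mul_of_semiconjBy hs.op hop)
    simpa only [← MulOpposite.op_mul, MulOpposite.unop_op, ← mul_assoc, ← hs.comm, ← hu.comm]
      using this
  have hidem : s * z * t = t * (u * x) := hleft.trans hright.symm
  calc t * x = t * (u * x) * x := by rw [mul_assoc, hu.self_mul_mul]
    _ = z * (s * t) * x := by rw [← hidem, hs.comm, mul_assoc z]
    _ = z * (t * (u * x)) := by rw [← h.eq, mul_assoc, mul_assoc]
    _ = z * t := by rw [← hidem, ← mul_assoc, hs.mul_self_mul]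

theorem commute (h : IsGDrazinInverse a x) (hy : Commute a y) : Commute x y :=
  (h.semiconjBy h hy.symm).symm

theorem commute_mul (h : IsGDrazinInverse a x) (hy : Commute a y) : Commute (a * x) y :=
  hy.mul_left (h.commute hy)

theorem commute_one_sub (h : IsGDrazinInverse a x) (hy : Commute a y) :
    Commute (1 - a * x) y :=
  (Commute.one_left y).sub_left (h.commute_mul hy)

theorem mul_mul_mul_of_commute (h : IsGDrazinInverse a x) (hb : Commute a (a * x * b)) :
    a * x * b * (a * x) = a * x * b := by
  rw [← (h.commute_mul hb).eq, ← mul_assoc, h.isIdempotentElem.eq]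

theorem mul (ha : IsGDrazinInverse a x) (hb : IsGDrazinInverse b y) (hab : Commute a b) :
    IsGDrazinInverse (a * b) (x * y) := by
  have hxb : Commute x b := ha.commute hab
  have hay : Commute a y := (hb.commute hab.symm).symm
  have hxy : Commute x y := ha.commute hay
  have hmul : a * b * (x * y) = a * x * (b * y) := by
    rw [mul_assoc, ← mul_assoc b, ← hxb.eq, mul_assoc x, mul_assoc]
  have hpb : Commute (a * x) b := ha.commute_mul hab
  have hcomm : Commute (a * b) (x * y) :=
    ((show Commute a x from ha.comm).mul_right hay).mul_left (hxb.symm.mul_right hb.comm)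
  have houter : x * y * (a * b) * (x * y) = x * y := by
    have hqx : Commute (b * y) x := hxb.symm.mul_left hxy.symm
    rw [← hcomm.eq, hmul, mul_assoc (a * x), ← mul_assoc (b * y), hqx.eq, ← mul_assoc,
      ← mul_assoc (a * x), ha.self_mul_mul, mul_assoc, hb.self_mul_mul]
  refine of_isQuasinilpotent_mul_one_sub houter hcomm ?_
  have hleft : IsQuasinilpotent (a * (1 - a * x) * b) :=
    ha.isQuasinilpotent_mul_one_sub.mul_of_commute (hab.mul_left (ha.commute_one_sub hab))
  have hright : IsQuasinilpotent (b * (1 - b * y) * (a * (a * x))) := by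
    refine hb.isQuasinilpotent_mul_one_sub.mul_of_commute ?_
    have hba : Commute (b * (1 - b * y)) a := hab.symm.mul_left (hb.commute_one_sub hab.symm)
    have hbx : Commute (b * (1 - b * y)) x := hxb.symm.mul_left (hb.commute_one_sub hxb.symm)
    exact hba.mul_right (hba.mul_right hbx)
  have hprod : b * (1 - b * y) * (a * (a * x)) * (a * (1 - a * x) * b) = 0 := by
    have hzero : a * x * (a * (1 - a * x)) = 0 := by
      linear_combination (norm := noncomm_ring) -ha.one_sub_mul_self_mul_one_sub
    linear_combination (norm := noncomm_ring) b * (1 - b * y) * a * hzero * b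
  have hsum : b * (1 - b * y) * (a * (a * x)) + a * (1 - a * x) * b =
      a * b * (1 - a * b * (x * y)) := by
    have hcore : Commute (a * (a * x)) (b * (1 - b * y)) :=
      (hab.mul_left hpb).mul_right ((Commute.one_right _).sub_right
        ((hab.mul_left hpb).mul_right (hay.mul_left (ha.commute_mul hay))))
    rw [hmul, ← hcore.eq]
    linear_combination (norm := noncomm_ring) -a * hpb.eq * b * y
  exact hsum ▸ hright.add_of_mul_eq_zero hleft hprod

end IsGDrazinInverse

theorem one_sub_mul_mul_one_sub_iff {R : Type*} [Ring R] {p s : R} :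
    (1 - p) * s * (1 - p) = s * (1 - p) ↔ p * s * p = p * s := by
  constructor <;> intro h <;> linear_combination (norm := noncomm_ring) h

theorem mul_mul_mul_of_mul_mul {R : Type*} [Semigroup R] {p s t : R} (hs : p * s * p = p * s)
    (ht : p * t * p = p * t) : p * (s * t) * p = p * (s * t) := by
  rw [← mul_assoc, ← hs, mul_assoc _ p t, mul_assoc, ht, ← mul_assoc, hs, mul_assoc]

namespace IsGDrazinInverse

variable {A : Type*} [NormedRing A] [NormedAlgebra ℂ A] {p r s w x z : A}

theorem mul_corner_inv (hp : IsIdempotentElem p) (hw : IsGDrazinInverse (p * s) w) :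
    p * w = w := by
  have hzero : (1 - p) * w = 0 :=
    hw.mul_eq_zero (by rw [← mul_assoc, hp.one_sub_mul_self, zero_mul])
  rw [sub_mul, one_mul, sub_eq_zero] at hzero
  exact hzero.symm

theorem corner_inv_mul (hps : p * s * p = p * s) (hw : IsGDrazinInverse (p * s) w) :
    w * p = w := by
  have hzero : w * (1 - p) = 0 := hw.mul_eq_zero' (by rw [mul_sub, mul_one, hps, sub_self])
  rw [mul_sub, mul_one, sub_eq_zero] at hzero
  exact hzero.symm

variable [CompleteSpace A]

theorem mul_mul_eq_of_left (hp : IsIdempotentElem p) (hps : p * s * p = p * s)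
    (hs : IsGDrazinInverse s z) (hx : IsGDrazinInverse (p * s) x) : p * z * p = p * z := by
  have hpz : p * z = x * p := hx.semiconjBy hs hps.symm
  rw [hpz, mul_assoc, hp.eq]

theorem mul_mul_eq_of_right (hr : IsIdempotentElem r) (hrs : r * s * r = s * r)
    (hs : IsGDrazinInverse s z) (hx : IsGDrazinInverse (s * r) x) : r * z * r = z * r := by
  have hrz : r * x = z * r := hs.semiconjBy hx ((mul_assoc r s r).symm.trans hrs)
  rw [mul_assoc, ← hrz, ← mul_assoc, hr.eq]

theorem corner_left (hps : p * s * p = p * s) (hpz : p * z * p = p * z)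
    (hs : IsGDrazinInverse s z) : IsGDrazinInverse (p * s) (p * z) := by
  have hmul : p * s * (p * z) = p * (s * z) := by rw [← mul_assoc, hps, mul_assoc]
  have hmul' : p * z * (p * s) = p * (z * s) := by rw [← mul_assoc, hpz, mul_assoc]
  have hq : p * (s * (1 - s * z)) * p = p * (s * (1 - s * z)) := by
    have hssz := mul_mul_mul_of_mul_mul hps (mul_mul_mul_of_mul_mul hps hpz)
    linear_combination (norm := noncomm_ring) hps - hssz
  refine of_isQuasinilpotent_mul_one_sub ?_ (by rw [hmul, hmul', hs.comm]) ?_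
  · rw [mul_assoc, hmul, ← mul_assoc, hpz, mul_assoc, hs.mul_self_mul]
  · convert hs.isQuasinilpotent_mul_one_sub.mul_of_mul_mul_eq hq using 1
    rw [hmul]
    linear_combination (norm := noncomm_ring) -hps * s * z

theorem corner_right (hrs : r * s * r = s * r) (hrz : r * z * r = z * r)
    (hs : IsGDrazinInverse s z) : IsGDrazinInverse (s * r) (z * r) := by
  refine unop ?_
  rw [MulOpposite.op_mul, MulOpposite.op_mul]
  refine hs.op.corner_left ?_ ?_ <;>
    simp only [← MulOpposite.op_mul, ← mul_assoc, hrs, hrz]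

theorem mul_mul_eq_of_corner (hp : IsIdempotentElem p) (hps : p * s * p = p * s)
    (hs : IsGDrazinInverse s z)
    (hcorner : IsGDrazinInvertible ((1 - p) * s * (1 - p)) ∨ IsGDrazinInvertible ((1 - p) * s) ∨
      IsGDrazinInvertible (s * (1 - p)) ∨ IsGDrazinInvertible (p * s * p) ∨
      IsGDrazinInvertible (p * s) ∨ IsGDrazinInvertible (s * p)) :
    p * z * p = p * z := by
  have hrs : (1 - p) * s * (1 - p) = s * (1 - p) := one_sub_mul_mul_one_sub_iff.2 hps
  have hright {x : A} (hx : IsGDrazinInverse (s * (1 - p)) x) : p * z * p = p * z :=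
    one_sub_mul_mul_one_sub_iff.1 (mul_mul_eq_of_right hp.one_sub hrs hs hx)
  have hleft {x : A} (hx : IsGDrazinInverse (p * s) x) : p * z * p = p * z :=
    mul_mul_eq_of_left hp hps hs hx
  rw [hrs, hps] at hcorner
  rcases hcorner with ⟨x, hx⟩ | ⟨x, hx⟩ | ⟨x, hx⟩ | ⟨x, hx⟩ | ⟨x, hx⟩ | ⟨x, hx⟩
  exacts [hright hx, hright hx.cline, hright hx, hleft hx, hleft hx, hleft hx.cline]

end IsGDrazinInverse

section Triangular

variable {A : Type*} [NormedRing A] {c d m p s w y : A}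

/-- The series `∑ (1 - d y) dⁿ m wⁿ⁺²`. For generalized Drazin inverses `w` of `c` and `y` of `d`,
it solves the Sylvester equation `X c - d X = (1 - d y) m w`. -/
noncomputable def leftSylvesterSeries (w m d y : A) : A :=
  ∑' n : ℕ, (1 - d * y) * d ^ n * m * w ^ (n + 2)

/-- The series `∑ yⁿ⁺² m cⁿ (1 - c w)`. For generalized Drazin inverses `w` of `c` and `y` of `d`,
it solves the Sylvester equation `d X - X c = y m (1 - c w)`. -/
noncomputable def rightSylvesterSeries (c w m y : A) : A :=
  ∑' n : ℕ, y ^ (n + 2) * m * c ^ n * (1 - c * w)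

/-- The entry below the diagonal in the generalized Drazin inverse of the block matrix
`[[c, 0], [m, d]]`, where `w` and `y` are the generalized Drazin inverses of `c` and `d`. -/
noncomputable def gDrazinLowerEntry (c w m d y : A) : A :=
  leftSylvesterSeries w m d y + rightSylvesterSeries c w m y - y * m * w

theorem op_rightSylvesterSeries (hc : Commute c w) (m y : A) :
    MulOpposite.op (rightSylvesterSeries c w m y) =
      leftSylvesterSeries (MulOpposite.op y) (MulOpposite.op m) (MulOpposite.op c)
        (MulOpposite.op w) := by
  simp only [rightSylvesterSeries, leftSylvesterSeries, ← tsum_op, MulOpposite.op_mul,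
    MulOpposite.op_sub, MulOpposite.op_one, MulOpposite.op_pow, mul_assoc, hc.eq]

variable [NormedAlgebra ℂ A]

theorem IsGDrazinInverse.triangular_of_sylvester {x : A} (hp : IsIdempotentElem p)
    (hps : p * s * p = p * s) (hw : IsGDrazinInverse (p * s) w)
    (hy : IsGDrazinInverse (s * (1 - p)) y) (hpx : p * x = 0) (hxp : x * p = x)
    (hsylvester : x * (p * s) - s * (1 - p) * x = (1 - p) * s * p * w - y * ((1 - p) * s * p))
    (houter : x * (p * s) * w + y * ((1 - p) * s * p) * w + y * (s * (1 - p)) * x = x) :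
    IsGDrazinInverse s (w + x + y) := by
  have hpd : p * (s * (1 - p)) = 0 := by
    linear_combination (norm := noncomm_ring) -hps
  have hpw : p * w = w := hw.mul_corner_inv hp
  have hwp : w * p = w := hw.corner_inv_mul hps
  have hpy : p * y = 0 := hy.mul_eq_zero hpd
  have hyp : y * p = 0 := hy.mul_eq_zero' (by rw [mul_assoc, hp.one_sub_mul_self, mul_zero])
  have hpT : p * (w + x + y) = w := by
    linear_combination (norm := noncomm_ring) hpx + hpy + hpw
  have hTp : (w + x + y) * (1 - p) = y := by
    linear_combination (norm := noncomm_ring) -hwp - hxp - hyp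
  have hpsT : p * s * (w + x + y) = p * s * w := by
    rw [← hps, mul_assoc, hpT, hps]
  have hsT : s * (w + x + y) =
      p * s * w + (1 - p) * s * p * w + s * (1 - p) * x + s * (1 - p) * y := by
    linear_combination (norm := noncomm_ring) hps * w - s * hpw + s * hpx + s * hpy
  have hTs : (w + x + y) * s =
      w * (p * s) + x * (p * s) + y * ((1 - p) * s * p) + y * (s * (1 - p)) := by
    linear_combination (norm := noncomm_ring) -hwp * s - hxp * s + hyp * s * p
  have hcomm : s * (w + x + y) = (w + x + y) * s := by
    rw [hsT, hTs]
    linear_combination (norm := noncomm_ring) hw.comm + hy.comm - hsylvester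
  refine of_isQuasinilpotent_mul_one_sub ?_ hcomm ?_
  · rw [hTs]
    linear_combination (norm := noncomm_ring) hw.outer + hy.outer + houter + (w + x) * hpsT
      + y * (1 - p) * s * hpT - y * (1 - p) * s * hpw - y * s * hpw
  · have hleft : p * (s * (1 - s * (w + x + y))) = p * s * (1 - p * s * w) := by
      linear_combination (norm := noncomm_ring) hps * s * (w + x + y) - p * s * hpsT
    have hright : s * (1 - s * (w + x + y)) * (1 - p) = s * (1 - p) * (1 - s * (1 - p) * y) := by
      linear_combination (norm := noncomm_ring) -s * s * hTp - s * s * hpy - s * hpd * y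
    refine IsQuasinilpotent.of_corners (p := p) ?_ ?_ ?_
    · rw [hleft]
      linear_combination (norm := noncomm_ring) hps - p * s * p * s * hwp
    · exact hleft ▸ hw.isQuasinilpotent_mul_one_sub
    · exact hright ▸ hy.isQuasinilpotent_mul_one_sub

variable [CompleteSpace A]

theorem hasSum_leftSylvesterSeries (hd : IsGDrazinInverse d y) :
    HasSum (fun n : ℕ => (1 - d * y) * d ^ n * m * w ^ (n + 2)) (leftSylvesterSeries w m d y) := by
  refine Summable.hasSum ?_
  convert hd.isQuasinilpotent_mul_one_sub.summable_pow_mul_mul_pow ((1 - d * y) * m * w ^ 2) w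
    using 2 with n
  rw [← hd.pow_mul_one_sub, add_comm n, pow_add]
  simp only [mul_assoc]

theorem mul_leftSylvesterSeries (hd : IsGDrazinInverse d y) :
    y * leftSylvesterSeries w m d y = 0 := by
  have hzero : y * (1 - d * y) = 0 := by rw [mul_sub, mul_one, hd.mul_self_mul, sub_self]
  refine ((hasSum_leftSylvesterSeries hd).mul_left y).unique ?_
  simpa only [← mul_assoc, hzero, zero_mul] using hasSum_zero

theorem leftSylvesterSeries_mul_mul (hc : IsGDrazinInverse c w) (hd : IsGDrazinInverse d y) :
    leftSylvesterSeries w m d y * (c * w) = leftSylvesterSeries w m d y := by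
  have hterm (n : ℕ) : w ^ (n + 2) * (c * w) = w ^ (n + 2) := by
    rw [pow_succ, mul_assoc, hc.mul_self_mul]
  refine ((hasSum_leftSylvesterSeries hd).mul_right (c * w)).unique ?_
  simpa only [mul_assoc _ (w ^ _), hterm] using hasSum_leftSylvesterSeries hd

theorem leftSylvesterSeries_mul (hc : IsGDrazinInverse c w) (hd : IsGDrazinInverse d y) :
    leftSylvesterSeries w m d y * c =
      (1 - d * y) * m * w + d * leftSylvesterSeries w m d y := by
  have hsum := hasSum_leftSylvesterSeries (w := w) (m := m) hd
  have hterm (n : ℕ) : (1 - d * y) * d ^ n * m * w ^ (n + 2) * c =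
      (1 - d * y) * d ^ n * m * w ^ (n + 1) := by
    rw [mul_assoc, pow_add, mul_assoc (w ^ n), pow_two, hc.mul_mul_self, ← pow_succ]
  have hshift (n : ℕ) : (1 - d * y) * d ^ (n + 1) * m * w ^ (n + 1 + 1) =
      d * ((1 - d * y) * d ^ n * m * w ^ (n + 2)) := by
    have hcomm : Commute d (1 - d * y) := (Commute.one_right d).sub_right hd.commute_self_mul
    rw [pow_succ' d, ← mul_assoc (1 - d * y), ← hcomm.eq]
    simp only [mul_assoc]
  have hmul := hsum.mul_right c
  simp only [hterm] at hmul
  rw [← hmul.tsum_eq, hmul.summable.tsum_eq_zero_add, leftSylvesterSeries,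
    ← hsum.summable.tsum_mul_left]
  simp only [hshift, pow_zero, zero_add, pow_one, mul_one]

theorem hasSum_rightSylvesterSeries (hc : IsGDrazinInverse c w) :
    HasSum (fun n : ℕ => y ^ (n + 2) * m * c ^ n * (1 - c * w))
      (rightSylvesterSeries c w m y) := by
  rw [← hasSum_op, op_rightSylvesterSeries hc.comm]
  refine (hasSum_leftSylvesterSeries hc.op).congr_fun fun n => ?_
  simp only [MulOpposite.op_mul, MulOpposite.op_sub, MulOpposite.op_one,
    MulOpposite.op_pow, mul_assoc, hc.comm]

theorem rightSylvesterSeries_mul (hc : IsGDrazinInverse c w) :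
    rightSylvesterSeries c w m y * w = 0 := by
  apply MulOpposite.op_injective
  rw [MulOpposite.op_mul, op_rightSylvesterSeries hc.comm, mul_leftSylvesterSeries hc.op,
    MulOpposite.op_zero]

theorem mul_mul_rightSylvesterSeries (hc : IsGDrazinInverse c w) (hd : IsGDrazinInverse d y) :
    y * d * rightSylvesterSeries c w m y = rightSylvesterSeries c w m y := by
  apply MulOpposite.op_injective
  rw [MulOpposite.op_mul, MulOpposite.op_mul, op_rightSylvesterSeries hc.comm,
    leftSylvesterSeries_mul_mul hd.op hc.op]

theorem mul_rightSylvesterSeries (hc : IsGDrazinInverse c w) (hd : IsGDrazinInverse d y) :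
    d * rightSylvesterSeries c w m y =
      y * m * (1 - c * w) + rightSylvesterSeries c w m y * c := by
  apply MulOpposite.op_injective
  rw [MulOpposite.op_mul, op_rightSylvesterSeries hc.comm, leftSylvesterSeries_mul hd.op hc.op,
    ← op_rightSylvesterSeries hc.comm]
  simp only [MulOpposite.op_mul, MulOpposite.op_sub, MulOpposite.op_one, MulOpposite.op_add,
    mul_assoc, hc.comm]

theorem gDrazinLowerEntry_mul_sub (hc : IsGDrazinInverse c w) (hd : IsGDrazinInverse d y) :
    gDrazinLowerEntry c w m d y * c - d * gDrazinLowerEntry c w m d y = m * w - y * m := by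
  rw [gDrazinLowerEntry]
  linear_combination (norm := noncomm_ring) leftSylvesterSeries_mul (m := m) hc hd -
    mul_rightSylvesterSeries (m := m) hc hd + y * m * hc.comm

theorem gDrazinLowerEntry_outer (hc : IsGDrazinInverse c w) (hd : IsGDrazinInverse d y) :
    gDrazinLowerEntry c w m d y * c * w + y * m * w + y * d * gDrazinLowerEntry c w m d y =
      gDrazinLowerEntry c w m d y := by
  rw [gDrazinLowerEntry]
  linear_combination (norm := noncomm_ring)
    leftSylvesterSeries_mul_mul (m := m) hc hd + mul_mul_rightSylvesterSeries (m := m) hc hd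
      + rightSylvesterSeries_mul (m := m) (y := y) hc * c
      + rightSylvesterSeries c w m y * hc.comm + d * mul_leftSylvesterSeries (w := w) (m := m) hd
      - hd.comm * leftSylvesterSeries w m d y - y * m * hc.mul_self_mul - hd.outer * m * w

theorem mul_gDrazinLowerEntry_eq_zero {t : A} (hc : IsGDrazinInverse c w)
    (hd : IsGDrazinInverse d y) (htd : t * d = 0) (htm : t * m = 0) :
    t * gDrazinLowerEntry c w m d y = 0 := by
  have hty : t * y = 0 := hd.mul_eq_zero htd
  have hleft : t * leftSylvesterSeries w m d y = 0 := by
    rw [← leftSylvesterSeries_mul_mul hc hd, ← mul_assoc (leftSylvesterSeries w m d y),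
      leftSylvesterSeries_mul hc hd]
    linear_combination (norm := noncomm_ring) htm * w * w - htd * y * m * w * w
      + htd * leftSylvesterSeries w m d y * w
  have hright : t * rightSylvesterSeries c w m y = 0 := by
    rw [← mul_mul_rightSylvesterSeries hc hd, mul_assoc, ← mul_assoc, hty, zero_mul]
  rw [gDrazinLowerEntry]
  linear_combination (norm := noncomm_ring) hleft + hright - hty * m * w

theorem gDrazinLowerEntry_mul_eq_zero {t : A} (hc : IsGDrazinInverse c w)
    (hd : IsGDrazinInverse d y) (hct : c * t = 0) (hmt : m * t = 0) :
    gDrazinLowerEntry c w m d y * t = 0 := by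
  have hwt : w * t = 0 := hc.mul_eq_zero' hct
  have hleft : leftSylvesterSeries w m d y * t = 0 := by
    rw [← leftSylvesterSeries_mul_mul hc hd, mul_assoc, mul_assoc c, hwt, mul_zero, mul_zero]
  have hright : rightSylvesterSeries c w m y * t = 0 := by
    rw [← mul_mul_rightSylvesterSeries hc hd, mul_assoc y, mul_rightSylvesterSeries hc hd]
    linear_combination (norm := noncomm_ring) y * y * hmt - y * y * m * c * hwt
      + y * rightSylvesterSeries c w m y * hct
  rw [gDrazinLowerEntry]
  linear_combination (norm := noncomm_ring) hleft + hright - y * m * hwt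

theorem IsGDrazinInverse.triangular (hp : IsIdempotentElem p) (hps : p * s * p = p * s)
    (hw : IsGDrazinInverse (p * s) w) (hy : IsGDrazinInverse (s * (1 - p)) y) :
    IsGDrazinInverse s
      (w + gDrazinLowerEntry (p * s) w ((1 - p) * s * p) (s * (1 - p)) y + y) := by
  have hpd : p * (s * (1 - p)) = 0 := by
    linear_combination (norm := noncomm_ring) -hps
  have hpm : p * ((1 - p) * s * p) = 0 := by
    rw [mul_assoc, ← mul_assoc, hp.mul_one_sub_self, zero_mul]
  have hmp : (1 - p) * s * p * (1 - p) = 0 := by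
    rw [mul_assoc, hp.mul_one_sub_self, mul_zero]
  have hxp := gDrazinLowerEntry_mul_eq_zero hw hy ((mul_assoc p s _).trans hpd) hmp
  rw [mul_sub, mul_one, sub_eq_zero] at hxp
  exact triangular_of_sylvester hp hps hw hy (mul_gDrazinLowerEntry_eq_zero hw hy hpd hpm)
    hxp.symm (gDrazinLowerEntry_mul_sub hw hy) (gDrazinLowerEntry_outer hw hy)

theorem isGDrazinInvertible_iff_corner (hp : IsIdempotentElem p) (hps : p * s * p = p * s)
    (hright : IsGDrazinInvertible (s * (1 - p))) :
    IsGDrazinInvertible s ↔ IsGDrazinInvertible (p * s) := by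
  obtain ⟨y, hy⟩ := hright
  refine ⟨fun ⟨z, hz⟩ => ⟨p * z, ?_⟩, fun ⟨w, hw⟩ => ⟨_, hw.triangular hp hps hy⟩⟩
  have hrs : (1 - p) * s * (1 - p) = s * (1 - p) := one_sub_mul_mul_one_sub_iff.2 hps
  have hrz := hz.mul_mul_eq_of_right hp.one_sub hrs hy
  exact hz.corner_left hps (one_sub_mul_mul_one_sub_iff.1 hrz)

end Triangular
section Perturbation

variable {A : Type*} [NormedRing A] [NormedAlgebra ℂ A] [CompleteSpace A] {a b k q x y : A}

theorem IsQuasinilpotent.hasSum_neg_pow_mul_pow (hk : IsQuasinilpotent k) (x : A) :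
    HasSum (fun n : ℕ => (-k) ^ n * x ^ (n + 1)) (∑' n : ℕ, (-k) ^ n * x ^ (n + 1)) := by
  refine Summable.hasSum ?_
  simpa only [pow_succ', mul_assoc] using hk.neg.summable_pow_mul_mul_pow x x

theorem IsGDrazinInverse.add_of_commute_isQuasinilpotent (ha : IsGDrazinInverse a x)
    (hk : IsQuasinilpotent k) (hak : Commute a k) :
    IsGDrazinInverse (a + k) (∑' n : ℕ, (-k) ^ n * x ^ (n + 1)) := by
  have hsum := hk.hasSum_neg_pow_mul_pow x
  set T := ∑' n : ℕ, (-k) ^ n * x ^ (n + 1)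
  have hcommute {t : A} (htk : Commute t k) (htx : Commute t x) : Commute t T :=
    Commute.tsum_right t fun n => (htk.neg_right.pow_right n).mul_right (htx.pow_right (n + 1))
  have hkx : Commute k x := (ha.commute hak).symm
  have hTa : Commute a T := hcommute hak ha.comm
  have hTk : Commute k T := hcommute (Commute.refl k) hkx
  have hrec : T = x - k * T * x := by
    have hshift (n : ℕ) : (-k) ^ (n + 1) * x ^ (n + 1 + 1) = -k * ((-k) ^ n * x ^ (n + 1)) * x := by
      rw [pow_succ' (-k), pow_succ x (n + 1)]
      simp only [mul_assoc]
    have htail := ((hsum.mul_left (-k)).mul_right x).tsum_eq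
    simp only [← hshift] at htail
    have hsplit : T = (-k) ^ 0 * x ^ (0 + 1) + -k * T * x := by
      rw [← htail]
      exact hsum.summable.tsum_eq_zero_add
    linear_combination (norm := noncomm_ring) hsplit
  have hTax : T * (a * x) = T := by
    refine (hsum.mul_right (a * x)).unique ?_
    simpa only [pow_succ, mul_assoc, ha.mul_self_mul] using hsum
  have hmul : (a + k) * T = a * x := by
    have haT : a * T = a * x - k * (T * (a * x)) := by
      linear_combination (norm := noncomm_ring) a * hrec - hak.eq * T * x - k * hTa.eq * x
    rw [add_mul, haT, hTax, sub_add_cancel]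
  have hmul' : T * (a + k) = a * x := by rw [← (hTa.add_left hTk).eq, hmul]
  refine of_isQuasinilpotent_mul_one_sub ?_ (hmul.trans hmul'.symm) ?_
  · rw [mul_assoc, hmul, hTax]
  · rw [hmul, add_mul]
    have hkax : Commute k (1 - a * x) := (ha.commute_one_sub hak).symm
    refine ha.isQuasinilpotent_mul_one_sub.add_of_commute (hk.mul_of_commute hkax) ?_
    have haax : Commute a (1 - a * x) := (Commute.one_right a).sub_right ha.commute_self_mul
    exact (hak.mul_left (ha.commute_one_sub hak)).mul_right
      (haax.mul_left (Commute.refl (1 - a * x)))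

theorem IsGDrazinInverse.hasSum_mul_one_sub {w : A} (ha : IsGDrazinInverse a x)
    (hb : IsGDrazinInverse b y) (hw : IsGDrazinInverse (a + b) w) (hab : Commute a b) :
    HasSum (fun n : ℕ => (1 - b * y) * (-b) ^ n * x ^ (n + 1)) (w * (1 - b * y)) := by
  have hidem : IsIdempotentElem (1 - b * y) := hb.isIdempotentElem.one_sub
  have hself : IsGDrazinInverse (1 - b * y) (1 - b * y) :=
    of_isIdempotentElem hidem
  have hra : Commute (1 - b * y) a := hb.commute_one_sub hab.symm
  have hrb : Commute (1 - b * y) b := hb.commute_one_sub (Commute.refl b)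
  have hrx : Commute (1 - b * y) x := (ha.commute hra.symm).symm
  have hcorner : Commute (a * (1 - b * y)) (b * (1 - b * y)) :=
    (hab.mul_right hra.symm).mul_left (hrb.mul_right (Commute.refl _))
  have hsum := hb.isQuasinilpotent_mul_one_sub.hasSum_neg_pow_mul_pow (x * (1 - b * y))
  have hinv := (ha.mul hself hra.symm).add_of_commute_isQuasinilpotent
    hb.isQuasinilpotent_mul_one_sub hcorner
  rw [← add_mul] at hinv
  rw [← hinv.unique (hw.mul hself (hra.add_right hrb).symm)]
  refine hsum.congr_fun fun n => ?_
  rw [← neg_mul, hrb.symm.neg_left.mul_pow, hrx.symm.mul_pow, hidem.pow_succ_eq,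
    ← (hrx.pow_right (n + 1)).eq, (hrb.neg_right.pow_right n).eq, mul_assoc, mul_assoc,
    ← mul_assoc ((1 - b * y) ^ n), ← pow_succ, hidem.pow_succ_eq]

/-- The series `∑ yⁿ⁺¹ qⁿ`, which is the generalized Drazin inverse of `q + b` when `q` is
quasinilpotent with `q b y = 0` and `q` commutes with `b (1 - b y)`, where `y` is the generalized
Drazin inverse of `b`. -/
noncomputable def gDrazinAddSeries (y q : A) : A :=
  ∑' n : ℕ, y ^ (n + 1) * q ^ n

theorem hasSum_gDrazinAddSeries (hq : IsQuasinilpotent q) (y : A) :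
    HasSum (fun n : ℕ => y ^ (n + 1) * q ^ n) (gDrazinAddSeries y q) := by
  refine Summable.hasSum ?_
  simpa only [pow_succ] using hq.summable_pow_mul_mul_pow' y y

theorem gDrazinAddSeries_eq (hq : IsQuasinilpotent q) (y : A) :
    gDrazinAddSeries y q = y + y * gDrazinAddSeries y q * q := by
  have hsum := hasSum_gDrazinAddSeries hq y
  have hshift (n : ℕ) : y ^ (n + 1 + 1) * q ^ (n + 1) = y * (y ^ (n + 1) * q ^ n) * q := by
    rw [pow_succ' y (n + 1), pow_succ q]
    simp only [mul_assoc]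
  have htail := ((hsum.mul_left y).mul_right q).tsum_eq
  simp only [← hshift] at htail
  rw [← htail]
  conv_lhs => rw [gDrazinAddSeries, hsum.summable.tsum_eq_zero_add]
  simp only [zero_add, pow_one, pow_zero, mul_one]

theorem mul_mul_gDrazinAddSeries (hq : IsQuasinilpotent q) (hb : IsGDrazinInverse b y) :
    b * y * gDrazinAddSeries y q = gDrazinAddSeries y q := by
  refine ((hasSum_gDrazinAddSeries hq y).mul_left (b * y)).unique ?_
  have hterm (n : ℕ) : b * y * y ^ (n + 1) = y ^ (n + 1) := by
    rw [pow_succ', ← mul_assoc, hb.self_mul_mul]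
  simpa only [← mul_assoc, hterm] using hasSum_gDrazinAddSeries hq y

theorem mul_gDrazinAddSeries_eq_zero (hq : IsQuasinilpotent q) (hb : IsGDrazinInverse b y)
    (hqb : q * (b * y) = 0) : q * gDrazinAddSeries y q = 0 := by
  rw [← mul_mul_gDrazinAddSeries hq hb, ← mul_assoc, hqb, zero_mul]

theorem gDrazinAddSeries_pow_succ (hq : IsQuasinilpotent q) (hb : IsGDrazinInverse b y)
    (hqb : q * (b * y) = 0) (m : ℕ) :
    gDrazinAddSeries y q ^ (m + 1) = y ^ m * gDrazinAddSeries y q := by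
  have hself : gDrazinAddSeries y q * gDrazinAddSeries y q = y * gDrazinAddSeries y q := by
    conv_lhs => enter [1]; rw [gDrazinAddSeries_eq hq y]
    rw [add_mul, mul_assoc _ q, mul_gDrazinAddSeries_eq_zero hq hb hqb, mul_zero, add_zero]
  induction m with
  | zero => simp only [zero_add, pow_one, pow_zero, one_mul]
  | succ m ih => rw [pow_succ, ih, mul_assoc, hself, ← mul_assoc, pow_succ]

theorem gDrazinAddSeries_mul (hq : IsQuasinilpotent q) (hb : IsGDrazinInverse b y)
    (hqb : q * (b * y) = 0) (hcomm : Commute q (b * (1 - b * y))) :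
    gDrazinAddSeries y q * b = b * y := by
  have hyb : y * (b * (1 - b * y)) = 0 := by
    rw [← mul_assoc, ← hb.comm, hb.isIdempotentElem.mul_one_sub_self]
  have hyb' : gDrazinAddSeries y q * (b * (1 - b * y)) =
      y * (gDrazinAddSeries y q * (b * (1 - b * y))) * q := by
    conv_lhs => rw [gDrazinAddSeries_eq hq y]
    linear_combination (norm := noncomm_ring) hyb + y * gDrazinAddSeries y q * hcomm.eq
  have hzero := hq.eq_zero_of_eq_mul_mul hyb'
  have hqbb : q * b * (b * y) = 0 := by
    rw [mul_assoc, hb.commute_self_mul.eq, ← mul_assoc, hqb, zero_mul]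
  have hrec := gDrazinAddSeries_eq hq y
  have hbb : gDrazinAddSeries y q * b * (b * y) = b * y := by
    linear_combination (norm := noncomm_ring) hrec * b * (b * y) +
      y * gDrazinAddSeries y q * hqbb - hb.comm * b * y + hb.isIdempotentElem.eq
  linear_combination (norm := noncomm_ring) hzero + hbb

theorem IsQuasinilpotent.one_sub_mul_add (hb : IsGDrazinInverse b y) (hq : IsQuasinilpotent q)
    (hqb : q * (b * y) = 0) (hcomm : Commute q (b * (1 - b * y))) :
    IsQuasinilpotent ((1 - b * y) * q + b * (1 - b * y)) := by
  have hcompress : (1 - b * y) * q * (1 - b * y) = (1 - b * y) * q := by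
    linear_combination (norm := noncomm_ring) -(1 - b * y) * hqb
  have hcommute : Commute ((1 - b * y) * q) (b * (1 - b * y)) := by
    have hright : b * (1 - b * y) * (1 - b * y) = b * (1 - b * y) := by
      rw [mul_assoc, hb.isIdempotentElem.one_sub.eq]
    have hleft : (1 - b * y) * (b * (1 - b * y)) = b * (1 - b * y) := by
      linear_combination (norm := noncomm_ring) hb.commute_self_mul.eq * (1 - b * y) + hright
    rw [Commute, SemiconjBy, mul_assoc, hcomm.eq, ← mul_assoc, hleft, ← mul_assoc, hright]
  exact (hq.mul_of_mul_mul_eq hcompress).add_of_commute hb.isQuasinilpotent_mul_one_sub hcommute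

theorem IsGDrazinInverse.add_of_isQuasinilpotent (hb : IsGDrazinInverse b y)
    (hq : IsQuasinilpotent q) (hqb : q * (b * y) = 0) (hcomm : Commute q (b * (1 - b * y))) :
    IsGDrazinInverse (q + b) (gDrazinAddSeries y q) := by
  have hbY := mul_mul_gDrazinAddSeries hq hb
  have hqY := mul_gDrazinAddSeries_eq_zero hq hb hqb
  have hYb := gDrazinAddSeries_mul hq hb hqb hcomm
  have hrec := gDrazinAddSeries_eq hq y
  set Y := gDrazinAddSeries y q
  have hmul : (q + b) * Y = b * y + Y * q := by
    linear_combination (norm := noncomm_ring) hqY + b * hrec + hbY * q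
  have hmul' : Y * (q + b) = b * y + Y * q := by
    rw [mul_add, hYb, add_comm]
  refine of_isQuasinilpotent_mul_one_sub ?_ (hmul.trans hmul'.symm) ?_
  · linear_combination (norm := noncomm_ring) hmul' * Y + hbY + Y * hqY
  · have hqP : (q + b) * (1 - (q + b) * Y) * (b * y) = 0 := by
      linear_combination (norm := noncomm_ring)
        -(q + b) * hmul * b * y - (q + b) * hb.isIdempotentElem.eq - (q + b) * Y * hqb
    refine IsQuasinilpotent.of_corners (p := 1 - b * y) ?_ ?_ ?_
    · rw [mul_assoc, mul_sub, mul_one, hqP, sub_zero]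
    · convert IsQuasinilpotent.one_sub_mul_add hb hq hqb hcomm using 1
      linear_combination (norm := noncomm_ring)
        -(1 - b * y) * (q + b) * hmul - (1 - b * y) * hqb - (1 - b * y) * hqY * q -
          hb.commute_self_mul.eq * (b * y + Y * q - 1) + b * hb.isIdempotentElem.eq + b * hbY * q
    · rw [sub_sub_cancel, hqP]
      exact IsQuasinilpotent.zero

end Perturbation

section Pair

variable {A : Type*} [NormedRing A] [NormedAlgebra ℂ A]

/-- Elements `a` and `b` with generalized Drazin inverses `x` and `z`, satisfying the two algebraic
relations of the theorem, such that `b` and `z` are both lower triangular with respect to the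
idempotent `a x`. Triangularity of `b` follows from `Commute a (a x b)`; that of `z` is what the
six corner conditions of the theorem have in common. -/
structure IsTriangularPair (a x b z : A) : Prop where
  left : IsGDrazinInverse a x
  right : IsGDrazinInverse b z
  mul_mul_eq : a * b * (1 - a * x) = (1 - a * x) * (1 - b * z) * b * a * (1 - b * z) * (1 - a * x)
  commute : Commute a (a * x * b)
  mul_inv_mul : a * x * z * (a * x) = a * x * z

/-- The series `∑ zⁿ⁺¹ aⁿ (1 - a x)`. It is the generalized Drazin inverse of the corner
`(a + b) (1 - a x)` of the sum of a triangular pair. -/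
noncomputable def complementSeries (a x z : A) : A :=
  ∑' n : ℕ, z ^ (n + 1) * a ^ n * (1 - a * x)

theorem mul_pow_mul_of_mul_mul {R : Type*} [Monoid R] {r s : R} (hrs : r * s * r = s * r)
    (n : ℕ) : r * (s * r) ^ n = s ^ n * r :=
  SemiconjBy.pow_right (show SemiconjBy r (s * r) s from (mul_assoc r s r).symm.trans hrs) n

theorem pow_mul_of_mul_mul {R : Type*} [Monoid R] {r s : R} (hr : IsIdempotentElem r)
    (hrs : r * s * r = s * r) (n : ℕ) : (s * r) ^ n * r = s ^ n * r := by
  have hcomm : Commute (s * r) r := by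
    rw [Commute, SemiconjBy, mul_assoc, hr.eq, ← mul_assoc, hrs]
  rw [(hcomm.pow_left n).eq, mul_pow_mul_of_mul_mul hrs]

namespace IsTriangularPair

variable {a b g w x z : A}

theorem isIdempotentElem (h : IsTriangularPair a x b z) : IsIdempotentElem (a * x) :=
  h.left.isIdempotentElem

theorem one_sub_mul_inv_mul (h : IsTriangularPair a x b z) :
    (1 - a * x) * z * (1 - a * x) = z * (1 - a * x) :=
  one_sub_mul_mul_one_sub_iff.2 h.mul_inv_mul

theorem corner_right_mul (h : IsTriangularPair a x b z) :
    b * (1 - a * x) * (z * (1 - a * x)) = b * z * (1 - a * x) := by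
  linear_combination (norm := noncomm_ring) b * h.one_sub_mul_inv_mul

theorem corner_pow_mul_corner_pow (h : IsTriangularPair a x b z) (n : ℕ) :
    (z * (1 - a * x)) ^ (n + 1) * (a * (1 - a * x)) ^ n = z ^ (n + 1) * a ^ n * (1 - a * x) := by
  have hr := h.isIdempotentElem.one_sub
  have ha := (mul_assoc _ _ _).trans h.left.one_sub_mul_self_mul_one_sub
  have hz : (z * (1 - a * x)) ^ (n + 1) = z ^ (n + 1) * (1 - a * x) := by
    rw [← pow_mul_of_mul_mul hr h.one_sub_mul_inv_mul, pow_succ, mul_assoc, mul_assoc z, hr.eq]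
  rw [hz, mul_assoc, mul_pow_mul_of_mul_mul ha, mul_assoc]

theorem gDrazinAddSeries_eq (h : IsTriangularPair a x b z) :
    gDrazinAddSeries (z * (1 - a * x)) (a * (1 - a * x)) = complementSeries a x z :=
  tsum_congr h.corner_pow_mul_corner_pow

theorem one_sub_mul_add_mul (h : IsTriangularPair a x b z) :
    (1 - a * x) * (a + b) * (a * x) = (1 - a * x) * b * (a * x) := by
  linear_combination (norm := noncomm_ring) h.left.commute_self_mul.eq * (a * x) -
    a * h.isIdempotentElem.eq

theorem commute_one_add (h : IsTriangularPair a x b z) : Commute a (1 + x * b) := by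
  have hxb : x * b = x * (a * x * b) := by rw [← mul_assoc, h.left.mul_self_mul]
  rw [hxb]
  exact (Commute.one_right a).add_right (Commute.mul_right h.left.comm h.commute)

variable [CompleteSpace A]

theorem mul_mul_mul (h : IsTriangularPair a x b z) : a * x * b * (a * x) = a * x * b :=
  h.left.mul_mul_mul_of_commute h.commute

theorem one_sub_mul_mul (h : IsTriangularPair a x b z) :
    (1 - a * x) * b * (1 - a * x) = b * (1 - a * x) :=
  one_sub_mul_mul_one_sub_iff.2 h.mul_mul_mul

theorem mul_add_mul (h : IsTriangularPair a x b z) :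
    a * x * (a + b) * (a * x) = a * x * (a + b) := by
  linear_combination (norm := noncomm_ring) h.mul_mul_mul +
    a * x * h.left.commute_self_mul.eq + h.isIdempotentElem.eq * a

theorem one_sub_mul_mul_inv_mul (h : IsTriangularPair a x b z) :
    (1 - a * x) * (b * z) * (1 - a * x) = b * z * (1 - a * x) := by
  linear_combination (norm := noncomm_ring) b * h.one_sub_mul_inv_mul +
    h.one_sub_mul_mul * z * (1 - a * x) - (1 - a * x) * b * h.one_sub_mul_inv_mul

theorem corner_left (h : IsTriangularPair a x b z) : IsGDrazinInverse (a * x * b) (a * x * z) :=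
  h.right.corner_left h.mul_mul_mul h.mul_inv_mul

theorem corner_right (h : IsTriangularPair a x b z) :
    IsGDrazinInverse (b * (1 - a * x)) (z * (1 - a * x)) :=
  h.right.corner_right h.one_sub_mul_mul h.one_sub_mul_inv_mul

theorem mul_mul_mul_one_sub (h : IsTriangularPair a x b z) :
    a * (b * z * (1 - a * x)) = 0 := by
  have hbz : (1 - b * z) * (b * z) = 0 := h.right.isIdempotentElem.one_sub_mul_self
  have hcorner := h.one_sub_mul_mul_inv_mul
  have habb : a * b * (b * z * (1 - a * x)) = 0 := by
    linear_combination (norm := noncomm_ring) h.mul_mul_eq * (b * z * (1 - a * x)) -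
      a * b * hcorner + (1 - a * x) * (1 - b * z) * b * a * (1 - b * z) * hcorner +
      (1 - a * x) * (1 - b * z) * b * a * hbz * (1 - a * x)
  linear_combination (norm := noncomm_ring) habb * z * (1 - a * x) -
    a * b * h.right.self_mul_mul * (1 - a * x) - a * b * b * z * h.one_sub_mul_inv_mul

theorem mul_corner_eq_zero (h : IsTriangularPair a x b z) :
    a * (1 - a * x) * (b * (1 - a * x) * (z * (1 - a * x))) = 0 := by
  rw [h.corner_right_mul, mul_assoc, ← mul_assoc (1 - a * x), h.one_sub_mul_mul_inv_mul,
    h.mul_mul_mul_one_sub]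

theorem mul_mul_one_sub_eq (h : IsTriangularPair a x b z) :
    a * b * (1 - a * x) = (1 - b * z) * b * a * (1 - a * x) := by
  have hb : (1 - a * x) * ((1 - b * z) * b) * (1 - a * x) = (1 - b * z) * b * (1 - a * x) := by
    linear_combination (norm := noncomm_ring) h.one_sub_mul_mul +
      (1 - a * x) * b * z * h.one_sub_mul_mul - h.one_sub_mul_mul_inv_mul * b * (1 - a * x) -
      b * z * h.one_sub_mul_mul
  have ha := h.left.one_sub_mul_self_mul_one_sub
  linear_combination (norm := noncomm_ring) h.mul_mul_eq -
    (1 - a * x) * (1 - b * z) * b * h.mul_mul_mul_one_sub + hb * a * (1 - a * x) +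
    (1 - b * z) * b * ha - (1 - a * x) * (1 - b * z) * b * ha

theorem commute_corner (h : IsTriangularPair a x b z) :
    Commute (a * (1 - a * x)) (b * (1 - a * x) * (1 - b * (1 - a * x) * (z * (1 - a * x)))) := by
  have ha := h.left.one_sub_mul_self_mul_one_sub
  have hbz := h.one_sub_mul_mul_inv_mul
  have hcomm := h.right.commute_self_mul.eq
  have hleft : a * (1 - a * x) * (b * (1 - a * x) * (1 - b * z * (1 - a * x))) =
      a * b * (1 - a * x) := by
    linear_combination (norm := noncomm_ring) a * h.one_sub_mul_mul -
      a * (1 - a * x) * b * hbz - a * (1 - a * x) * hcomm * (1 - a * x) +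
      a * (1 - a * x) * b * z * h.one_sub_mul_mul - a * hbz * b * (1 - a * x) -
      h.mul_mul_mul_one_sub * b * (1 - a * x)
  have hright : b * (1 - a * x) * (1 - b * z * (1 - a * x)) * (a * (1 - a * x)) =
      (1 - b * z) * b * a * (1 - a * x) := by
    linear_combination (norm := noncomm_ring) b * ha - b * hbz * a * (1 - a * x) -
      b * b * z * ha - hcomm * a * (1 - a * x)
  rw [h.corner_right_mul, Commute, SemiconjBy, hleft, hright, h.mul_mul_one_sub_eq]

theorem complement (h : IsTriangularPair a x b z) :
    IsGDrazinInverse ((a + b) * (1 - a * x)) (complementSeries a x z) := by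
  rw [add_mul, ← h.gDrazinAddSeries_eq]
  exact h.corner_right.add_of_isQuasinilpotent h.left.isQuasinilpotent_mul_one_sub
    h.mul_corner_eq_zero h.commute_corner

theorem hasSum_complementSeries (h : IsTriangularPair a x b z) :
    HasSum (fun n : ℕ => z ^ (n + 1) * a ^ n * (1 - a * x)) (complementSeries a x z) := by
  rw [← h.gDrazinAddSeries_eq]
  simpa only [h.corner_pow_mul_corner_pow] using
    hasSum_gDrazinAddSeries h.left.isQuasinilpotent_mul_one_sub (z * (1 - a * x))

theorem complementSeries_mul_one_sub (h : IsTriangularPair a x b z) :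
    complementSeries a x z * (1 - a * x) = complementSeries a x z := by
  refine (h.hasSum_complementSeries.mul_right (1 - a * x)).unique ?_
  simpa only [mul_assoc, h.isIdempotentElem.one_sub.eq] using h.hasSum_complementSeries

theorem mul_complementSeries (h : IsTriangularPair a x b z) :
    a * x * complementSeries a x z = 0 := by
  refine h.complement.mul_eq_zero ?_
  linear_combination (norm := noncomm_ring) -h.mul_add_mul

theorem complementSeries_mul (h : IsTriangularPair a x b z) :
    complementSeries a x z * (b * (1 - a * x)) = b * z * (1 - a * x) := by
  have hmul := gDrazinAddSeries_mul h.left.isQuasinilpotent_mul_one_sub h.corner_right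
    h.mul_corner_eq_zero h.commute_corner
  rwa [h.gDrazinAddSeries_eq, h.corner_right_mul] at hmul

theorem mul_mul_complementSeries (h : IsTriangularPair a x b z) :
    b * z * complementSeries a x z = complementSeries a x z := by
  refine (h.hasSum_complementSeries.mul_left (b * z)).unique ?_
  have hterm (n : ℕ) : b * z * z ^ (n + 1) = z ^ (n + 1) := by
    rw [pow_succ', ← mul_assoc, h.right.self_mul_mul]
  simpa only [← mul_assoc, hterm] using h.hasSum_complementSeries

theorem complementSeries_pow_succ (h : IsTriangularPair a x b z) (m : ℕ) :
    complementSeries a x z ^ (m + 1) = z ^ m * complementSeries a x z := by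
  have hpow := gDrazinAddSeries_pow_succ h.left.isQuasinilpotent_mul_one_sub h.corner_right
    h.mul_corner_eq_zero m
  rw [h.gDrazinAddSeries_eq] at hpow
  have hY : (1 - a * x) * complementSeries a x z = complementSeries a x z := by
    rw [sub_mul, one_mul, h.mul_complementSeries, sub_zero]
  rw [hpow, ← hY, ← mul_assoc, pow_mul_of_mul_mul h.isIdempotentElem.one_sub h.one_sub_mul_inv_mul,
    mul_assoc]

theorem one_sub_mul_add_pow_mul (h : IsTriangularPair a x b z) (n : ℕ) :
    (1 - a * x) * ((a + b) ^ n * (1 - a * x)) = (a + b) ^ n * (1 - a * x) := by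
  rw [← mul_pow_mul_of_mul_mul (one_sub_mul_mul_one_sub_iff.2 h.mul_add_mul), ← mul_assoc,
    h.isIdempotentElem.one_sub.eq]

theorem hasSum_complementSeries_pow_mul (h : IsTriangularPair a x b z) (c w : A) (n : ℕ) :
    HasSum (fun k : ℕ =>
        z ^ (n + k + 2) * a ^ k * (1 - a * x) * b * a * x * c ^ n * (1 - c * w))
      (complementSeries a x z ^ (n + 2) * ((1 - a * x) * (a + b) * (a * x)) * c ^ n *
        (1 - c * w)) := by
  have hsum := (h.hasSum_complementSeries.mul_left (z ^ (n + 1))).mul_right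
    (b * (a * x) * c ^ n * (1 - c * w))
  have hpow (k : ℕ) : z ^ (n + k + 2) = z ^ (n + 1) * z ^ (k + 1) := by
    rw [← pow_add, add_add_add_comm]
  rw [h.one_sub_mul_add_mul, h.complementSeries_pow_succ]
  have hmul : complementSeries a x z * ((1 - a * x) * b * (a * x)) =
      complementSeries a x z * (b * (a * x)) := by
    rw [mul_assoc (1 - a * x), ← mul_assoc (complementSeries a x z),
      h.complementSeries_mul_one_sub]
  rw [mul_assoc _ (complementSeries a x z), hmul]
  simpa only [hpow, mul_assoc] using hsum

theorem hasSum_rightSylvesterSeries (h : IsTriangularPair a x b z)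
    (hw : IsGDrazinInverse (a * x * (a + b)) w) :
    HasSum (fun n : ℕ => ∑' k : ℕ, z ^ (n + k + 2) * a ^ k * (1 - a * x) * b * a * x *
        (a * x * (a + b)) ^ n * (1 - a * x * (a + b) * w))
      (rightSylvesterSeries (a * x * (a + b)) w ((1 - a * x) * (a + b) * (a * x))
        (complementSeries a x z)) := by
  simpa only [(h.hasSum_complementSeries_pow_mul _ w _).tsum_eq] using
    _root_.hasSum_rightSylvesterSeries hw

theorem corner_mul_complementSeries (h : IsTriangularPair a x b z) :
    (a + b) * (1 - a * x) * complementSeries a x z =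
      (complementSeries a x z * a + b * z) * (1 - a * x) := by
  rw [h.complement.comm]
  linear_combination (norm := noncomm_ring) h.complementSeries_mul

theorem hasSum_complementSeries_mul_pow (h : IsTriangularPair a x b z) (n : ℕ) (t : A) :
    HasSum (fun k : ℕ => z ^ (k + 1) * a ^ (k + 1) * (a + b) ^ n * (1 - a * x) * b * t)
      (complementSeries a x z * (a * ((a + b) ^ n * (1 - a * x) * b * t))) := by
  have hcomm : Commute a (1 - a * x) :=
    (Commute.one_right a).sub_right h.left.commute_self_mul
  refine (h.hasSum_complementSeries.mul_right _).congr_fun fun k => ?_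
  have hmove : (1 - a * x) * (a * ((a + b) ^ n * (1 - a * x))) =
      a * ((a + b) ^ n * (1 - a * x)) := by
    rw [← mul_assoc, ← hcomm.eq, mul_assoc, h.one_sub_mul_add_pow_mul]
  rw [pow_succ a]
  linear_combination (norm := noncomm_ring) -z ^ (k + 1) * a ^ k * hmove * b * t

theorem leftSylvesterSeries_term (h : IsTriangularPair a x b z)
    (hw : IsGDrazinInverse (a * x * (a + b)) w) (n : ℕ) :
    (1 - (a + b) * (1 - a * x) * complementSeries a x z) * ((a + b) * (1 - a * x)) ^ n *
        ((1 - a * x) * (a + b) * (a * x)) * w ^ (n + 2) =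
      (1 - b * z) * (a + b) ^ n * (1 - a * x) * b * w ^ (n + 2) -
        complementSeries a x z * (a * ((a + b) ^ n * (1 - a * x) * b * w ^ (n + 2))) := by
  have hpw : a * x * w ^ (n + 2) = w ^ (n + 2) := by
    rw [pow_succ', ← mul_assoc, hw.mul_corner_inv h.isIdempotentElem]
  have hpow := pow_mul_of_mul_mul h.isIdempotentElem.one_sub
    (one_sub_mul_mul_one_sub_iff.2 h.mul_add_mul) n
  rw [h.corner_mul_complementSeries, h.one_sub_mul_add_mul]
  linear_combination (norm := noncomm_ring)
    (1 - (complementSeries a x z * a + b * z) * (1 - a * x)) *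
      (hpow * b * (a * x) * w ^ (n + 2) + (a + b) ^ n * (1 - a * x) * b * hpw) -
    (complementSeries a x z * a + b * z) * h.one_sub_mul_add_pow_mul n * b * w ^ (n + 2)

theorem hasSum_mul_leftSylvesterSeries (h : IsTriangularPair a x b z)
    (hw : IsGDrazinInverse (a * x * (a + b)) w) :
    HasSum (fun n : ℕ => (1 - b * z) * (a + b) ^ n * (1 - a * x) * b * w ^ (n + 2))
      ((1 - b * z) * leftSylvesterSeries w ((1 - a * x) * (a + b) * (a * x))
        ((a + b) * (1 - a * x)) (complementSeries a x z)) := by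
  have hsum := (hasSum_leftSylvesterSeries (w := w) (m := (1 - a * x) * (a + b) * (a * x))
    h.complement).mul_left (1 - b * z)
  simp only [h.leftSylvesterSeries_term hw] at hsum
  refine hsum.congr_fun fun n => ?_
  linear_combination (norm := noncomm_ring)
    -h.right.isIdempotentElem.eq * (a + b) ^ n * (1 - a * x) * b * w ^ (n + 2) -
    h.mul_mul_complementSeries * (a * ((a + b) ^ n * (1 - a * x) * b * w ^ (n + 2)))

theorem hasSum_tsum_sub_leftSylvesterSeries (h : IsTriangularPair a x b z)
    (hw : IsGDrazinInverse (a * x * (a + b)) w) :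
    HasSum (fun n : ℕ => ∑' k : ℕ,
        z ^ (k + 1) * a ^ (k + 1) * (a + b) ^ n * (1 - a * x) * b * w ^ (n + 2))
      ((1 - b * z) * leftSylvesterSeries w ((1 - a * x) * (a + b) * (a * x))
          ((a + b) * (1 - a * x)) (complementSeries a x z) -
        leftSylvesterSeries w ((1 - a * x) * (a + b) * (a * x))
          ((a + b) * (1 - a * x)) (complementSeries a x z)) := by
  have hleft := hasSum_leftSylvesterSeries (w := w) (m := (1 - a * x) * (a + b) * (a * x))
    h.complement
  simp only [h.leftSylvesterSeries_term hw] at hleft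
  simpa only [sub_sub_cancel, (h.hasSum_complementSeries_mul_pow _ _).tsum_eq] using
    (h.hasSum_mul_leftSylvesterSeries hw).sub hleft

theorem isGDrazinInverse_add (h : IsTriangularPair a x b z)
    (hw : IsGDrazinInverse (a * x * (a + b)) w) :
    IsGDrazinInverse (a + b)
      (w + (∑' n : ℕ, z ^ (n + 1) * a ^ n * (1 - a * x))
        - (∑' n : ℕ, z ^ (n + 1) * a ^ n * (1 - a * x) * b * w)
        + (∑' n : ℕ, ∑' k : ℕ, z ^ (n + k + 2) * a ^ k * (1 - a * x) * b * a * x *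
            (a * x * (a + b)) ^ n * (1 - a * x * (a + b) * w))
        + (∑' n : ℕ, (1 - b * z) * (a + b) ^ n * (1 - a * x) * b * w ^ (n + 2))
        - (∑' n : ℕ, ∑' k : ℕ,
            z ^ (k + 1) * a ^ (k + 1) * (a + b) ^ n * (1 - a * x) * b * w ^ (n + 2))) := by
  rw [h.hasSum_complementSeries.tsum_eq,
    ((h.hasSum_complementSeries.mul_right b).mul_right w).tsum_eq,
    (h.hasSum_rightSylvesterSeries hw).tsum_eq, (h.hasSum_mul_leftSylvesterSeries hw).tsum_eq,
    (h.hasSum_tsum_sub_leftSylvesterSeries hw).tsum_eq]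
  convert hw.triangular h.isIdempotentElem h.mul_add_mul h.complement using 1
  rw [gDrazinLowerEntry, h.one_sub_mul_add_mul]
  linear_combination (norm := noncomm_ring)
    complementSeries a x z * (1 - a * x) * b * hw.mul_corner_inv h.isIdempotentElem +
    h.complementSeries_mul_one_sub * b * w

theorem hasSum_mul_one_sub (h : IsTriangularPair a x b z)
    (hw : IsGDrazinInverse (a * x * (a + b)) w) :
    HasSum (fun n : ℕ => a * x * (1 - b * z) * (-b) ^ n * x ^ (n + 1)) (w * (1 - b * z)) := by
  have hbz : a * x * b * (a * x * z) = a * x * b * z := by rw [← mul_assoc, h.mul_mul_mul]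
  have hw' : IsGDrazinInverse (a * (a * x) + a * x * b) w := by
    rwa [h.left.commute_self_mul.eq, ← mul_add]
  have hsum := h.left.core.hasSum_mul_one_sub h.corner_left hw'
    (h.commute.mul_left (h.left.commute_mul h.commute))
  have hsemi : SemiconjBy (a * x) (-b) (-(a * x * b)) := by
    rw [SemiconjBy, neg_mul, h.mul_mul_mul, mul_neg]
  have hcorner : (1 - a * x * b * z) * (a * x) = a * x * (1 - b * z) := by
    linear_combination (norm := noncomm_ring)
      hbz * (a * x) - a * x * b * h.mul_inv_mul - hbz
  have hterm (n : ℕ) : a * x * (1 - b * z) * (-b) ^ n * x ^ (n + 1) =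
      (1 - a * x * b * z) * (-(a * x * b)) ^ n * x ^ (n + 1) := by
    have hx : x ^ (n + 1) = a * x * x ^ (n + 1) := by
      rw [pow_succ', ← mul_assoc, h.left.self_mul_mul]
    rw [← hcorner, mul_assoc _ (a * x), (hsemi.pow_right n).eq, ← mul_assoc, mul_assoc _ (a * x),
      ← hx]
  have hwp : w * (1 - a * x * b * z) = w * (1 - b * z) := by
    linear_combination (norm := noncomm_ring) -hw.corner_inv_mul h.mul_add_mul * b * z
  simpa only [hterm, ← hwp, hbz] using hsum

theorem corner_one_add (h : IsTriangularPair a x b z)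
    (hg : IsGDrazinInverse (1 + x * b) g) : IsGDrazinInverse (a * x * (a + b)) (x * g) := by
  have hcomm := h.commute_one_add
  have hmul : a * (a * x) * (1 + x * b) = a * x * (a + b) := by
    linear_combination (norm := noncomm_ring) h.left.commute_self_mul.eq +
      a * h.left.self_mul_mul * b
  exact hmul ▸ h.left.core.mul hg (hcomm.mul_left (h.left.commute_mul hcomm))

theorem eq_add_tsum (h : IsTriangularPair a x b z) (hw : IsGDrazinInverse (a * x * (a + b)) w)
    (hg : IsGDrazinInverse (1 + x * b) g) :
    w = x * g * b * z + ∑' n : ℕ, a * x * (1 - b * z) * (-b) ^ n * x ^ (n + 1) := by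
  rw [(h.hasSum_mul_one_sub hw).tsum_eq, ← hw.unique (h.corner_one_add hg)]
  noncomm_ring

theorem isGDrazinInvertible_add_iff (h : IsTriangularPair a x b z) :
    IsGDrazinInvertible (a + b) ↔ IsGDrazinInvertible (a * x * (a + b)) :=
  isGDrazinInvertible_iff_corner h.isIdempotentElem h.mul_add_mul ⟨_, h.complement⟩

theorem isGDrazinInvertible_one_add_iff (h : IsTriangularPair a x b z) :
    IsGDrazinInvertible (1 + x * b) ↔ IsGDrazinInvertible (a * x * (1 + x * b)) := by
  have hcomplement : (1 + x * b) * (1 - a * x) = 1 - a * x := by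
    linear_combination (norm := noncomm_ring)
      h.left.mul_self_mul * b * (a * x) - x * h.mul_mul_mul - h.left.mul_self_mul * b
  refine isGDrazinInvertible_iff_corner h.isIdempotentElem ?_ ⟨1 - a * x, ?_⟩
  · rw [(h.left.commute_mul h.commute_one_add).eq, mul_assoc, h.isIdempotentElem.eq]
  · rw [hcomplement]
    exact .of_isIdempotentElem h.isIdempotentElem.one_sub

theorem isGDrazinInvertible_corner_iff (h : IsTriangularPair a x b z) :
    IsGDrazinInvertible (a * x * (a + b)) ↔ IsGDrazinInvertible (a * x * (1 + x * b)) := by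
  have hax : Commute a (a * x) := h.left.commute_self_mul
  have hcore : a * (a * x) * (a * x * (1 + x * b)) = a * x * (a + b) := by
    linear_combination (norm := noncomm_ring) a * h.isIdempotentElem.eq * (1 + x * b) +
      hax.eq + a * h.left.self_mul_mul * b
  have hinverse : x * (a * x * (a + b)) = a * x * (1 + x * b) := by
    linear_combination (norm := noncomm_ring) h.left.mul_self_mul * (a + b) -
      h.left.comm - h.left.self_mul_mul * b
  constructor
  · rintro ⟨w, hw⟩
    have hcomm : Commute a (a * x * (a + b)) := by
      rw [mul_add]
      exact (hax.mul_right (Commute.refl a)).add_right h.commute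
    exact ⟨_, hinverse ▸ h.left.inverse.mul hw (h.left.commute hcomm)⟩
  · rintro ⟨g, hg⟩
    have hcomm : Commute a (a * x * (1 + x * b)) := hax.mul_right h.commute_one_add
    exact ⟨_, hcore ▸ h.left.core.mul hg (hcomm.mul_left (h.left.commute_mul hcomm))⟩

theorem tfae (h : IsTriangularPair a x b z) :
    [IsGDrazinInvertible (a + b), IsGDrazinInvertible (1 + x * b),
      IsGDrazinInvertible (a * x * (1 + x * b)), IsGDrazinInvertible ((1 + x * b) * (a * x)),
      IsGDrazinInvertible (a * x * (1 + x * b) * (a * x))].TFAE := by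
  have hcomm := h.left.commute_mul h.commute_one_add
  have hcorner : a * x * (1 + x * b) * (a * x) = a * x * (1 + x * b) := by
    rw [mul_assoc, ← hcomm.eq, ← mul_assoc, h.isIdempotentElem.eq]
  rw [hcorner, ← hcomm.eq]
  tfae_have 1 ↔ 3 := h.isGDrazinInvertible_add_iff.trans h.isGDrazinInvertible_corner_iff
  tfae_have 2 ↔ 3 := h.isGDrazinInvertible_one_add_iff
  tfae_have 3 ↔ 4 := Iff.rfl
  tfae_have 3 ↔ 5 := Iff.rfl
  tfae_finish

end IsTriangularPair

end Pair

theorem theorem2p2 {A : Type*} [NormedRing A] [NormedAlgebra ℂ A] [CompleteSpace A]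
    (a b : A) (ha : IsGDrazinInvertible a) (hb : IsGDrazinInvertible b)
    (hab : a * b * aᵖ = aᵖ * bᵖ * b * a * bᵖ * aᵖ)
    (hcomm : a ^ 2 * aᵈ * b = a * aᵈ * b * a)
    (hcorner : IsGDrazinInvertible (aᵖ * b * aᵖ) ∨ IsGDrazinInvertible (aᵖ * b) ∨
      IsGDrazinInvertible (b * aᵖ) ∨ IsGDrazinInvertible (a * aᵈ * b * (a * aᵈ)) ∨
      IsGDrazinInvertible (a * aᵈ * b) ∨ IsGDrazinInvertible (b * (a * aᵈ))) :
    [IsGDrazinInvertible (a + b),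
      IsGDrazinInvertible (1 + aᵈ * b),
      IsGDrazinInvertible (a * aᵈ * (1 + aᵈ * b)),
      IsGDrazinInvertible ((1 + aᵈ * b) * (a * aᵈ)),
      IsGDrazinInvertible (a * aᵈ * (1 + aᵈ * b) * (a * aᵈ))].TFAE ∧
    (IsGDrazinInvertible (a + b) →
      ∀ c : A, c = a * aᵈ * (a + b) →
        -- the generalized Drazin inverse of `c`
        IsGDrazinInvertible c ∧
        Summable (fun n : ℕ => a * aᵈ * bᵖ * (-b) ^ n * aᵈ ^ (n + 1)) ∧
        cᵈ = aᵈ * (1 + aᵈ * b)ᵈ * b * bᵈ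
          + ∑' n : ℕ, a * aᵈ * bᵖ * (-b) ^ n * aᵈ ^ (n + 1) ∧
        -- convergence of the series in the formula for `(a + b)ᵈ`
        Summable (fun n : ℕ => bᵈ ^ (n + 1) * a ^ n * aᵖ) ∧
        Summable (fun n : ℕ => bᵈ ^ (n + 1) * a ^ n * aᵖ * b * cᵈ) ∧
        (∀ n : ℕ, Summable (fun k : ℕ =>
          bᵈ ^ (n + k + 2) * a ^ k * aᵖ * b * a * aᵈ * c ^ n * cᵖ)) ∧
        Summable (fun n : ℕ => ∑' k : ℕ,
          bᵈ ^ (n + k + 2) * a ^ k * aᵖ * b * a * aᵈ * c ^ n * cᵖ) ∧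
        Summable (fun n : ℕ => bᵖ * (a + b) ^ n * aᵖ * b * cᵈ ^ (n + 2)) ∧
        (∀ n : ℕ, Summable (fun k : ℕ =>
          bᵈ ^ (k + 1) * a ^ (k + 1) * (a + b) ^ n * aᵖ * b * cᵈ ^ (n + 2))) ∧
        Summable (fun n : ℕ => ∑' k : ℕ,
          bᵈ ^ (k + 1) * a ^ (k + 1) * (a + b) ^ n * aᵖ * b * cᵈ ^ (n + 2)) ∧
        -- the formula for `(a + b)ᵈ`
        (a + b)ᵈ = cᵈ
          + (∑' n : ℕ, bᵈ ^ (n + 1) * a ^ n * aᵖ)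
          - (∑' n : ℕ, bᵈ ^ (n + 1) * a ^ n * aᵖ * b * cᵈ)
          + (∑' n : ℕ, ∑' k : ℕ,
              bᵈ ^ (n + k + 2) * a ^ k * aᵖ * b * a * aᵈ * c ^ n * cᵖ)
          + (∑' n : ℕ, bᵖ * (a + b) ^ n * aᵖ * b * cᵈ ^ (n + 2))
          - (∑' n : ℕ, ∑' k : ℕ,
              bᵈ ^ (k + 1) * a ^ (k + 1) * (a + b) ^ n * aᵖ * b * cᵈ ^ (n + 2))) := by
  obtain ⟨x, hx⟩ := ha
  obtain ⟨z, hz⟩ := hb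
  simp only [spectralIdem, hx.eq_gDrazinInv, hz.eq_gDrazinInv] at hab hcomm hcorner ⊢
  have hcomm : Commute a (a * x * b) :=
    show a * (a * x * b) = a * x * b * a by linear_combination (norm := noncomm_ring) hcomm
  have h : IsTriangularPair a x b z :=
    ⟨hx, hz, hab, hcomm, hz.mul_mul_eq_of_corner hx.isIdempotentElem
      (hx.mul_mul_mul_of_commute hcomm) hcorner⟩
  refine ⟨h.tfae, ?_⟩
  rintro hsum c rfl
  obtain ⟨w, hw⟩ := h.isGDrazinInvertible_add_iff.1 hsum
  obtain ⟨g, hg⟩ := (h.tfae.out 0 1).1 hsum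
  rw [hw.eq_gDrazinInv, hg.eq_gDrazinInv]
  exact ⟨⟨w, hw⟩, (h.hasSum_mul_one_sub hw).summable,
    h.eq_add_tsum hw hg, h.hasSum_complementSeries.summable,
    ((h.hasSum_complementSeries.mul_right b).mul_right w).summable,
    fun n => (h.hasSum_complementSeries_pow_mul _ w n).summable,
    (h.hasSum_rightSylvesterSeries hw).summable,
    (h.hasSum_mul_leftSylvesterSeries hw).summable,
    fun n => (h.hasSum_complementSeries_mul_pow n _).summable,
    (h.hasSum_tsum_sub_leftSylvesterSeries hw).summable,
    (h.isGDrazinInverse_add hw).eq_gDrazinInv⟩
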